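/- All manifolds, maps and vector fields are smooth. Let $Q$ be a finite-dimensional manifold and $k\ge 1$. For $r\ge 0$ let $T^rQ$ be the manifold of $r$-jets at $0$ of curves in $Q$, with natural coordinates $(q_0^A,\dots,q_r^A)$ ($q_i^A$ being the $i$-th derivative of the curve at $0$), with projections $\rho^s_r:T^sQ\to T^rQ$ for $r\le s$, and let $j_{r}:T^{s}Q\to T(T^{r-1}Q)$, $1\le r\le s$, be the canonical map $j_r(q_0,\dots,q_s)=(q_0,\dots,q_{r-1};q_1,\dots,q_r)$. On $T^kQ$ let $J_r=\sum_{i=0}^{k-r}\frac{(r+i)!}{i!}\,dq^A_i\otimes\frac{\partial}{\partial q^A_{r+i}}$ be the vertical endomorphisms and $\Delta_r=\sum_{i=0}^{k-r}\frac{(r+i)!}{i!}\,q^A_{i+1}\frac{\partial}{\partial q^A_{r+i}}$ the canonical vector fields, and let $d_T$ be Tulczyjew's derivation, given by $(d_Tf)(p)=df(j_{s+1}(p))$ for $f\in C^\infty(T^sQ)$, $p\in T^{s+1}Q$, and extended to forms as a derivation of degree $0$ commuting with $d$. Let $L\in C^\infty(T^kQ)$. Put $$\theta_L=\sum_{r=1}^k\frac{(-1)^{r-1}}{r!}\,d_T^{r-1}\bigl(dL\circ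 J_r\bigr)\in\Omega^1(T^{2k-1}Q),\qquad E_L=\sum_{r=1}^k\frac{(-1)^{r-1}}{r!}\,d_T^{r-1}\bigl(\Delta_r L\bigr)-(\rho^{2k-1}_k)^*L\in C^\infty(T^{2k-1}Q),$$ and let $FL:T^{2k-1}Q\to T^*(T^{k-1}Q)$ be the Legendre–Ostrogradsky map, the map over $T^{k-1}Q$ given by $\theta_L(u)=\langle FL(p),T\rho^{2k-1}_{k-1}u\rangle$ for $u\in T_p(T^{2k-1}Q)$. Let $\theta_{k-1}$ and $\omega_{k-1}=-d\theta_{k-1}$ be the canonical forms of $T^*(T^{k-1}Q)$. Let $W=T^{2k-1}Q\times_{T^{k-1}Q}T^*(T^{k-1}Q)$ with projections $\mathrm{pr}_1,\mathrm{pr}_2$, let $\Omega=\mathrm{pr}_2^*\omega_{k-1}$ and $H\in C^\infty(W)$, $H(p,\alpha)=\langle\alpha,j_k(p)\rangle-L(\rho^{2k-1}_k(p))$, and let $W_o=\{(p,FL(p))\}\subset W$ be the graph of $FL$. Denote by $\mathfrak X_{W_o}(W)$ the vector fields of $W$ with support on $W_o$ (smooth sections of $TW$ over $W_o$). For $X\in\mathfrak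 X_{W_o}(W)$ tangent to $W_o$ let $X_L$ be the unique vector field on $T^{2k-1}Q$ with $X_L(p)=T\mathrm{pr}_1\bigl(X(p,FL(p))\bigr)$ for all $p$. **Theorem.** Assume that $L$ is hyperregular, that is, $FL$ is a global diffeomorphism, and let $h\in C^\infty(T^*(T^{k-1}Q))$ be the Hamiltonian function, determined by $FL^*h=E_L$. 1. If $X\in\mathfrak X_{W_o}(W)$ is tangent to $W_o$ and satisfies $[\,i(X)\Omega-dH\,]|_{W_o}=0$, then $X_L$ is a smooth vector field, and the vector field $X_h=FL_*X_L$ on $T^*(T^{k-1}Q)$ is the unique solution of Hamilton's equation $i(X_h)\omega_{k-1}-dh=0$. 2. Conversely, if a vector field $X_h$ on $T^*(T^{k-1}Q)$ satisfies $i(X_h)\omega_{k-1}-dh=0$, then there is a unique $X\in\mathfrak X_{W_o}(W)$ that is tangent to $W_o$ and satisfies $[\,i(X)\Omega-dH\,]|_{W_o}=0$; moreover $FL_*X_L=X_h$ for this $X$. -/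

import Mathlib

open scoped Manifold ContDiff Topology

noncomputable section

namespace HigherOrder

section Jets

variable {E : Type*} [NormedAddCommGroup E] [NormedSpace ℝ E]
  {Q : Type*} [TopologicalSpace Q] [ChartedSpace E Q]

/-- The model space of `T^k Q`: coordinates `(q_0, …, q_k)` with each `q_i` in `E`. -/
abbrev JetModel (E : Type*) (k : ℕ) : Type _ := Fin (k + 1) → E

variable (E Q) in
/-- A curve in `Q` that is smooth near the parameter `0`. -/
structure LocalCurve where
  /-- the underlying map -/
  toFun : ℝ → Q
  smooth : ∀ᶠ t in 𝓝 (0 : ℝ), ContMDiffAt 𝓘(ℝ, ℝ) 𝓘(ℝ, E) ∞ toFun t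

variable (E Q) in
/-- Two curves are `k`-jet equivalent at `0` if they take the same value at `0` and, in a chart
around this value, have the same derivatives at `0` up to order `k`. -/
def jetSetoid (k : ℕ) : Setoid (LocalCurve E Q) where
  r σ τ := σ.toFun 0 = τ.toFun 0 ∧ ∀ i ≤ k,
    iteratedDeriv i (chartAt E (σ.toFun 0) ∘ σ.toFun) 0 =
      iteratedDeriv i (chartAt E (σ.toFun 0) ∘ τ.toFun) 0
  iseqv :=
    { refl := fun _ => ⟨rfl, fun _ _ => rfl⟩
      symm := fun h => ⟨h.1.symm, fun i hi => by rw [← h.1]; exact (h.2 i hi).symm⟩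
      trans := fun h h' => ⟨h.1.trans h'.1, fun i hi =>
        (h.2 i hi).trans (by rw [h.1]; exact h'.2 i hi)⟩ }

variable (E Q) in
/-- The `k`-th order tangent bundle `T^k Q`: the `k`-jets at `0` of curves in `Q`. -/
def Jet (k : ℕ) : Type _ := Quotient (jetSetoid E Q k)

/-- The `k`-jet at `0` of a curve. -/
def jet (k : ℕ) (σ : LocalCurve E Q) : Jet E Q k := Quotient.mk (jetSetoid E Q k) σ

/-- The projection `β^k : T^k Q → Q`. -/
def Jet.base {k : ℕ} (p : Jet E Q k) : Q :=
  Quotient.lift (s := jetSetoid E Q k) (fun σ => σ.toFun 0) (fun _ _ h => h.1) p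

/-- The projection `ρ^N_m : T^N Q → T^m Q`, for `m ≤ N`. -/
def Jet.proj {m N : ℕ} (h : m ≤ N) (p : Jet E Q N) : Jet E Q m :=
  Quotient.map' (s₁ := jetSetoid E Q N) (s₂ := jetSetoid E Q m) id
    (fun _ _ hστ => ⟨hστ.1, fun i hi => hστ.2 i (hi.trans h)⟩) p

/-- The coordinates `q_0, …, q_k` of a `k`-jet induced by a chart `e` of `Q`: the derivatives at `0`
of the local expression of a representative. -/
def Jet.coord {k : ℕ} (e : OpenPartialHomeomorph Q E) (p : Jet E Q k) : JetModel E k :=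
  fun i => iteratedDeriv i (e ∘ (Quotient.out (s := jetSetoid E Q k) p).toFun) 0

@[simp] lemma base_jet (k : ℕ) (σ : LocalCurve E Q) : (jet k σ).base = σ.toFun 0 := rfl

@[simp] lemma proj_jet {m N : ℕ} (h : m ≤ N) (σ : LocalCurve E Q) :
    (jet N σ).proj h = jet m σ := rfl

lemma jet_out {k : ℕ} (p : Jet E Q k) : jet k (Quotient.out (s := jetSetoid E Q k) p) = p :=
  Quotient.out_eq (s := jetSetoid E Q k) p

lemma exists_jet {k : ℕ} (p : Jet E Q k) : ∃ σ, jet k σ = p := ⟨_, jet_out p⟩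

@[simp] lemma base_proj {m N : ℕ} (h : m ≤ N) (p : Jet E Q N) : (p.proj h).base = p.base := by
  obtain ⟨σ, rfl⟩ := exists_jet p
  rfl

section Smooth

variable [IsManifold 𝓘(ℝ, E) ∞ Q]

lemma contDiffAt_transition {e e' : OpenPartialHomeomorph Q E} (he : e ∈ atlas E Q)
    (he' : e' ∈ atlas E Q) {y : E} (hy : y ∈ e.target) (hy' : e.symm y ∈ e'.source) :
    ContDiffAt ℝ ∞ (e' ∘ e.symm) y := by
  rw [← contMDiffAt_iff_contDiffAt]
  have h1 := contMDiffAt_symm_of_mem_maximalAtlas (I := 𝓘(ℝ, E)) (n := ∞)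
    (IsManifold.subset_maximalAtlas he) hy
  have h2 := contMDiffAt_of_mem_maximalAtlas (I := 𝓘(ℝ, E)) (n := ∞)
    (IsManifold.subset_maximalAtlas he') hy'
  exact h2.comp y h1

lemma LocalCurve.contDiffAt {e : OpenPartialHomeomorph Q E} (he : e ∈ atlas E Q)
    (σ : LocalCurve E Q) (hσ : σ.toFun 0 ∈ e.source) : ContDiffAt ℝ ∞ (e ∘ σ.toFun) 0 := by
  rw [← contMDiffAt_iff_contDiffAt]
  exact (contMDiffAt_of_mem_maximalAtlas (I := 𝓘(ℝ, E)) (n := ∞)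
    (IsManifold.subset_maximalAtlas he) hσ).comp 0 σ.smooth.self_of_nhds

lemma iteratedDeriv_transition {e e' : OpenPartialHomeomorph Q E} (he : e ∈ atlas E Q)
    (he' : e' ∈ atlas E Q) (σ : LocalCurve E Q) (hσ : σ.toFun 0 ∈ e.source)
    (hσ' : σ.toFun 0 ∈ e'.source) (i : ℕ) :
    iteratedDeriv i (e' ∘ σ.toFun) 0 = ∑ c : OrderedFinpartition i,
      iteratedFDeriv ℝ c.length (e' ∘ e.symm) (e (σ.toFun 0)) fun j =>
        iteratedDeriv (c.partSize j) (e ∘ σ.toFun) 0 := by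
  have hev : e' ∘ σ.toFun =ᶠ[𝓝 0] (e' ∘ e.symm) ∘ (e ∘ σ.toFun) := by
    have hc : ContinuousAt σ.toFun 0 := σ.smooth.self_of_nhds.continuousAt
    filter_upwards [hc.eventually (e.open_source.mem_nhds hσ)] with t ht
    simp [e.left_inv ht]
  rw [hev.iteratedDeriv_eq, iteratedDeriv_vcomp_eq_sum_orderedFinpartition (n := ∞)
    (contDiffAt_transition he he' (e.map_source hσ) (by simpa [e.left_inv hσ] using hσ'))
    (σ.contDiffAt he hσ) (by exact_mod_cast le_top)]
  rfl

lemma iteratedDeriv_chart_eq {k : ℕ} {σ τ : LocalCurve E Q} (h : jet k σ = jet k τ)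
    {e : OpenPartialHomeomorph Q E} (he : e ∈ atlas E Q) (hσ : σ.toFun 0 ∈ e.source)
    {i : ℕ} (hi : i ≤ k) :
    iteratedDeriv i (e ∘ σ.toFun) 0 = iteratedDeriv i (e ∘ τ.toFun) 0 := by
  obtain ⟨h0, h1⟩ := Quotient.exact (s := jetSetoid E Q k) h
  rw [iteratedDeriv_transition (chart_mem_atlas E (σ.toFun 0)) he σ (mem_chart_source _ _) hσ,
    iteratedDeriv_transition (chart_mem_atlas E (σ.toFun 0)) he τ
      (h0 ▸ mem_chart_source _ _) (h0 ▸ hσ), ← h0]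
  refine Finset.sum_congr rfl fun c _ => ?_
  congr 1
  funext j
  exact h1 _ ((c.partSize_le j).trans hi)

lemma coord_jet {k : ℕ} {e : OpenPartialHomeomorph Q E} (he : e ∈ atlas E Q)
    (σ : LocalCurve E Q) (hσ : σ.toFun 0 ∈ e.source) (i : Fin (k + 1)) :
    (jet k σ).coord e i = iteratedDeriv i (e ∘ σ.toFun) 0 := by
  have h := jet_out (jet k σ)
  have h0 := (Quotient.exact (s := jetSetoid E Q k) h).1
  exact iteratedDeriv_chart_eq h he (by rw [h0]; exact hσ) (Nat.lt_succ_iff.1 i.2)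

end Smooth

/-- The polynomial curve `t ↦ ∑ i, t ^ i / i! • q i`. -/
def taylorCurve {k : ℕ} (q : JetModel E k) (t : ℝ) : E :=
  ∑ i : Fin (k + 1), (t ^ (i : ℕ) / (i : ℕ).factorial) • q i

lemma contDiff_taylorCurve {k : ℕ} (q : JetModel E k) : ContDiff ℝ ∞ (taylorCurve q) := by
  unfold taylorCurve
  fun_prop

lemma iteratedDeriv_taylorCurve {k : ℕ} (q : JetModel E k) (i : Fin (k + 1)) :
    iteratedDeriv i (taylorCurve q) 0 = q i := by
  unfold taylorCurve
  rw [iteratedDeriv_fun_sum (fun j _ => by fun_prop)]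
  have h : ∀ j : Fin (k + 1),
      iteratedDeriv (i : ℕ) (fun t : ℝ => (t ^ (j : ℕ) / (j : ℕ).factorial) • q j) 0 =
        if i = j then q j else 0 := by
    intro j
    rw [iteratedDeriv_smul_const (by fun_prop), iteratedDeriv_div_const,
      iteratedDeriv_fun_pow_zero]
    by_cases hij : i = j
    · subst hij
      simp [Nat.factorial_ne_zero]
    · have : (i : ℕ) ≠ j := fun h => hij (Fin.ext h)
      simp [hij, this]
  rw [Finset.sum_congr rfl fun j _ => h j]
  simp

@[simp] lemma taylorCurve_zero {k : ℕ} (q : JetModel E k) : taylorCurve q 0 = q 0 := by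
  simpa using iteratedDeriv_taylorCurve q 0

variable [IsManifold 𝓘(ℝ, E) ∞ Q]

open Classical in
/-- A curve in `Q` whose local expression in the chart `e` is the polynomial with the prescribed
derivatives at `0` (a constant curve if `q 0` is not in the target of `e`). -/
def chartCurve {k : ℕ} (e : atlas E Q) (q : JetModel E k) : LocalCurve E Q :=
  if hq : q 0 ∈ e.1.target then
    { toFun := e.1.symm ∘ taylorCurve q
      smooth := by
        have hev : ∀ᶠ t in 𝓝 (0 : ℝ), taylorCurve q t ∈ e.1.target :=
          (contDiff_taylorCurve q).continuous.continuousAt.eventually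
            (e.1.open_target.mem_nhds (by simpa using hq))
        filter_upwards [hev] with t ht
        exact (contMDiffAt_symm_of_mem_maximalAtlas (I := 𝓘(ℝ, E)) (n := ∞)
          (IsManifold.subset_maximalAtlas e.2) ht).comp t
            (contDiff_taylorCurve q).contMDiff.contMDiffAt }
  else
    { toFun := fun _ => e.1.symm (q 0)
      smooth := Filter.Eventually.of_forall fun _ => contMDiffAt_const }

lemma chartCurve_toFun {k : ℕ} (e : atlas E Q) {q : JetModel E k} (hq : q 0 ∈ e.1.target) :
    (chartCurve e q).toFun = e.1.symm ∘ taylorCurve q := by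
  simp [chartCurve, hq]

lemma chartCurve_zero {k : ℕ} (e : atlas E Q) {q : JetModel E k} (hq : q 0 ∈ e.1.target) :
    (chartCurve e q).toFun 0 = e.1.symm (q 0) := by
  simp [chartCurve_toFun e hq]

lemma iteratedDeriv_chartCurve {k : ℕ} (e : atlas E Q) {q : JetModel E k}
    (hq : q 0 ∈ e.1.target) (i : Fin (k + 1)) :
    iteratedDeriv i (e.1 ∘ (chartCurve e q).toFun) 0 = q i := by
  have hev : e.1 ∘ (chartCurve e q).toFun =ᶠ[𝓝 0] taylorCurve q := by
    have : ∀ᶠ t in 𝓝 (0 : ℝ), taylorCurve q t ∈ e.1.target :=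
      (contDiff_taylorCurve q).continuous.continuousAt.eventually
        (e.1.open_target.mem_nhds (by simpa using hq))
    filter_upwards [this] with t ht
    simp [chartCurve_toFun e hq, e.1.right_inv ht]
  rw [hev.iteratedDeriv_eq, iteratedDeriv_taylorCurve]

lemma coord_zero {k : ℕ} {e : OpenPartialHomeomorph Q E} (he : e ∈ atlas E Q) {p : Jet E Q k}
    (hp : p.base ∈ e.source) : p.coord e 0 = e p.base := by
  obtain ⟨σ, rfl⟩ := exists_jet p
  simpa using coord_jet (k := k) he σ hp 0

/-- The chart of `T^k Q` with coordinates `(q_0, …, q_k)` induced by a chart `e` of `Q`. -/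
def jetChart (k : ℕ) (e : atlas E Q) : PartialEquiv (Jet E Q k) (JetModel E k) where
  toFun p := p.coord e.1
  invFun q := jet k (chartCurve e q)
  source := {p | p.base ∈ e.1.source}
  target := {q | q 0 ∈ e.1.target}
  map_source' p hp := by
    rw [Set.mem_ofPred_eq, coord_zero e.2 hp]
    exact e.1.map_source hp
  map_target' q hq := by
    rw [Set.mem_ofPred_eq, base_jet, chartCurve_zero e hq]
    exact e.1.map_target hq
  left_inv' p hp := by
    have hq : p.coord e.1 0 ∈ e.1.target := by
      rw [coord_zero e.2 hp]; exact e.1.map_source hp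
    have h0 : (chartCurve e (p.coord e.1)).toFun 0 = p.base := by
      rw [chartCurve_zero e hq, coord_zero e.2 hp, e.1.left_inv hp]
    obtain ⟨σ, rfl⟩ := exists_jet p
    · change σ.toFun 0 ∈ e.1.source at hp
      rw [base_jet] at h0
      refine Quotient.sound (s := jetSetoid E Q k) ⟨h0, fun i hi => ?_⟩
      rw [h0, iteratedDeriv_transition e.2 (chart_mem_atlas E _) _ (h0 ▸ hp)
          (h0 ▸ mem_chart_source _ _),
        iteratedDeriv_transition e.2 (chart_mem_atlas E _) σ hp (mem_chart_source _ _), h0]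
      refine Finset.sum_congr rfl fun c _ => ?_
      congr 1
      funext j
      have hj : c.partSize j < k + 1 := Nat.lt_succ_of_le ((c.partSize_le j).trans hi)
      have h1 := iteratedDeriv_chartCurve e (q := (jet k σ).coord e.1) hq ⟨_, hj⟩
      exact h1.trans (coord_jet e.2 σ hp ⟨_, hj⟩)
  right_inv' q hq := by
    funext i
    rw [coord_jet e.2 _ (by rw [chartCurve_zero e hq]; exact e.1.map_target hq),
      iteratedDeriv_chartCurve e hq]

lemma jetChart_transition (k : ℕ) (e e' : atlas E Q) {q : JetModel E k} (hq : q 0 ∈ e.1.target)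
    (hq' : e.1.symm (q 0) ∈ e'.1.source) (i : Fin (k + 1)) :
    jetChart k e' ((jetChart k e).symm q) i = ∑ c : OrderedFinpartition (i : ℕ),
      iteratedFDeriv ℝ c.length (e'.1 ∘ e.1.symm) (q 0) fun j =>
        q ⟨c.partSize j, (c.partSize_le j).trans_lt i.2⟩ := by
  have h0 := chartCurve_zero e hq
  change (jet k (chartCurve e q)).coord e'.1 i = _
  rw [coord_jet e'.2 _ (by rw [h0]; exact hq'),
    iteratedDeriv_transition e.2 e'.2 _ (by rw [h0]; exact e.1.map_target hq)
      (by rw [h0]; exact hq'), h0, e.1.right_inv hq]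
  refine Finset.sum_congr rfl fun c _ => ?_
  congr 1
  funext j
  exact iteratedDeriv_chartCurve e hq ⟨_, (c.partSize_le j).trans_lt i.2⟩

lemma jetChart_trans_source (k : ℕ) (e e' : atlas E Q) :
    ((jetChart k e).symm.trans (jetChart k e')).source =
      {q | q 0 ∈ (e.1.symm.trans e'.1).source} := by
  ext q
  rw [PartialEquiv.trans_source]
  simp only [PartialEquiv.symm_source, Set.mem_inter_iff, Set.mem_preimage, Set.mem_ofPred_eq,
    OpenPartialHomeomorph.trans_source, OpenPartialHomeomorph.symm_source]
  refine and_congr_right fun hq => ?_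
  change (chartCurve e q).toFun 0 ∈ e'.1.source ↔ _
  rw [chartCurve_zero e hq]

lemma contDiffOn_jetChart_transition (k : ℕ) (e e' : atlas E Q) :
    ContDiffOn ℝ ∞ ((jetChart k e).symm.trans (jetChart k e'))
      ((jetChart k e).symm.trans (jetChart k e')).source := by
  intro q hq
  rw [jetChart_trans_source] at hq ⊢
  have hq1 : q 0 ∈ e.1.target ∧ e.1.symm (q 0) ∈ e'.1.source := by simpa using hq
  have hev : ∀ᶠ q' in 𝓝 q, q' 0 ∈ (e.1.symm.trans e'.1).source :=
    (continuous_apply 0).continuousAt.eventually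
      ((e.1.symm.trans e'.1).open_source.mem_nhds hq)
  refine ContDiffAt.contDiffWithinAt ?_
  rw [contDiffAt_pi]
  intro i
  have hsm : ContDiffAt ℝ ∞ (fun q : JetModel E k => ∑ c : OrderedFinpartition (i : ℕ),
      iteratedFDeriv ℝ c.length (e'.1 ∘ e.1.symm) (q 0) fun j =>
        q ⟨c.partSize j, (c.partSize_le j).trans_lt i.2⟩) q := by
    refine ContDiffAt.sum fun c _ => ?_
    have h1 : ContDiffAt ℝ ∞ (fun q : JetModel E k =>
        iteratedFDeriv ℝ c.length (e'.1 ∘ e.1.symm) (q 0)) q :=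
      ((contDiffAt_transition e.2 e'.2 hq1.1 hq1.2).iteratedFDeriv_right (m := ∞)
        (i := c.length) (by exact_mod_cast le_top)).comp q (contDiff_apply ℝ E 0).contDiffAt
    have h2 : ContDiffAt ℝ ∞ (fun q : JetModel E k => fun j : Fin c.length =>
        q ⟨c.partSize j, (c.partSize_le j).trans_lt i.2⟩) q := by fun_prop
    have h3 : ContDiff ℝ ∞ fun x : (E [×c.length]→L[ℝ] E) × (Fin c.length → E) => x.1 x.2 :=
      ((ContinuousLinearMap.id ℝ
        (E [×c.length]→L[ℝ] E)).analyticOnNhd_uncurry_of_multilinear (s := Set.univ)).contDiff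
    exact h3.contDiffAt.comp q (h1.prodMk h2)
  refine hsm.congr_of_eventuallyEq ?_
  filter_upwards [hev] with q' hq'
  have hq2 : q' 0 ∈ e.1.target ∧ e.1.symm (q' 0) ∈ e'.1.source := by simpa using hq'
  exact jetChart_transition k e e' hq2.1 hq2.2 i

variable (E Q) in
/-- The charts of `T^k Q` induced by the charts of `Q`. -/
def jetCore (k : ℕ) : ChartedSpaceCore (JetModel E k) (Jet E Q k) where
  atlas := Set.range (jetChart k)
  chartAt p := jetChart k ⟨chartAt E p.base, chart_mem_atlas E _⟩
  mem_chart_source p := mem_chart_source E p.base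
  chart_mem_atlas p := Set.mem_range_self _
  open_source := by
    rintro _ _ ⟨e, rfl⟩ ⟨e', rfl⟩
    rw [jetChart_trans_source]
    exact (e.1.symm.trans e'.1).open_source.preimage (continuous_apply 0)
  continuousOn_toFun := by
    rintro _ _ ⟨e, rfl⟩ ⟨e', rfl⟩
    exact (contDiffOn_jetChart_transition k e e').continuousOn

instance (k : ℕ) : TopologicalSpace (Jet E Q k) := (jetCore E Q k).toTopologicalSpace

instance (k : ℕ) : ChartedSpace (JetModel E k) (Jet E Q k) := (jetCore E Q k).toChartedSpace

instance (k : ℕ) : IsManifold 𝓘(ℝ, JetModel E k) ∞ (Jet E Q k) := by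
  refine isManifold_of_contDiffOn _ _ _ fun e e' he he' => ?_
  have hmem : ∀ e ∈ atlas (JetModel E k) (Jet E Q k), ∃ f : atlas E Q,
      e.toPartialEquiv = jetChart k f := by
    intro e he
    simp only [atlas, ChartedSpace.atlas, Set.mem_iUnion] at he
    obtain ⟨_, ⟨f, rfl⟩, rfl⟩ := he
    exact ⟨f, rfl⟩
  obtain ⟨f, hf⟩ := hmem e he
  obtain ⟨f', hf'⟩ := hmem e' he'
  have key := contDiffOn_jetChart_transition k f f'
  rw [← hf, ← hf'] at key
  simpa using key

lemma coord_proj {m N : ℕ} (h : m ≤ N) {e : OpenPartialHomeomorph Q E} (he : e ∈ atlas E Q)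
    {p : Jet E Q N} (hp : p.base ∈ e.source) (i : Fin (m + 1)) :
    (p.proj h).coord e i = p.coord e (Fin.castLE (by omega) i) := by
  obtain ⟨σ, rfl⟩ := exists_jet p
  rw [proj_jet, coord_jet he σ hp, coord_jet he σ hp]
  rfl

lemma chartAt_jet_apply {k : ℕ} (p p' : Jet E Q k) :
    chartAt (JetModel E k) p p' = p'.coord (chartAt E p.base) := rfl

lemma chartAt_jet_source {k : ℕ} (p : Jet E Q k) :
    (chartAt (JetModel E k) p).source = {p' | p'.base ∈ (chartAt E p.base).source} := rfl

lemma contMDiff_proj {m N : ℕ} (h : m ≤ N) :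
    ContMDiff 𝓘(ℝ, JetModel E N) 𝓘(ℝ, JetModel E m) ∞ (Jet.proj h : Jet E Q N → Jet E Q m) := by
  intro p
  let r : JetModel E N → JetModel E m := fun q i => q (Fin.castLE (by omega) i)
  have hr : ContDiff ℝ ∞ r := by fun_prop
  have hcoord : ∀ p' ∈ (chartAt (JetModel E N) p).source,
      chartAt (JetModel E m) (p.proj h) (p'.proj h) = r (chartAt (JetModel E N) p p') := by
    intro p' hp'
    funext i
    rw [chartAt_jet_apply, chartAt_jet_apply, base_proj]
    exact coord_proj h (chart_mem_atlas E _) hp' i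
  have h1 : ContMDiffAt 𝓘(ℝ, JetModel E N) 𝓘(ℝ, JetModel E N) ∞ (chartAt (JetModel E N) p) p :=
    contMDiffAt_of_mem_maximalAtlas (IsManifold.chart_mem_maximalAtlas p) (mem_chart_source _ p)
  have h2 : ContMDiffAt 𝓘(ℝ, JetModel E m) 𝓘(ℝ, JetModel E m) ∞
      (chartAt (JetModel E m) (p.proj h)).symm (r (chartAt (JetModel E N) p p)) := by
    rw [← hcoord p (mem_chart_source _ p)]
    exact contMDiffAt_symm_of_mem_maximalAtlas (IsManifold.chart_mem_maximalAtlas _)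
      (mem_chart_target _ _)
  refine ((h2.comp _ hr.contMDiff.contMDiffAt).comp p h1).congr_of_eventuallyEq ?_
  filter_upwards [(chartAt (JetModel E N) p).open_source.mem_nhds (mem_chart_source _ p)]
    with p' hp'
  have hp'' : p'.proj h ∈ (chartAt (JetModel E m) (p.proj h)).source := by
    rw [chartAt_jet_source] at hp' ⊢
    simpa using hp'
  simp only [Function.comp_apply]
  rw [← hcoord p' hp', OpenPartialHomeomorph.left_inv _ hp'']

variable (E Q) in
/-- The projection `ρ^N_m` as a smooth map. -/
def projMap {m N : ℕ} (h : m ≤ N) :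
    C^∞⟮𝓘(ℝ, JetModel E N), Jet E Q N; 𝓘(ℝ, JetModel E m), Jet E Q m⟯ :=
  ⟨Jet.proj h, contMDiff_proj h⟩

end Jets

section Forms

variable {F H M : Type*} [NormedAddCommGroup F] [NormedSpace ℝ F] [TopologicalSpace H]
  [TopologicalSpace M] [ChartedSpace H M]

/-- The exterior derivative of a `1`-form `α` on a manifold without boundary,
`dα (u, v) = D_u a (v) - D_v a (u)`, where `a` is the local expression of `α` in the chart at `x`
and the tangent space at `x` is identified with the model space by this chart (as Mathlib does). -/
def extDerivOne (I : ModelWithCorners ℝ F H) (α : ∀ x : M, TangentSpace I x →L[ℝ] ℝ) (x : M) :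
    TangentSpace I x →L[ℝ] TangentSpace I x →L[ℝ] ℝ :=
  let a : F → F →L[ℝ] ℝ := fun y =>
    (α ((extChartAt I x).symm y)).comp (mfderiv 𝓘(ℝ, F) I (extChartAt I x).symm y)
  let D : F →L[ℝ] F →L[ℝ] ℝ := fderiv ℝ a (extChartAt I x x)
  D - D.flip

/-- A vector field `X` on a manifold is smooth. -/
def IsSmoothField (I : ModelWithCorners ℝ F H) [IsManifold I 1 M]
    (X : ∀ x : M, TangentSpace I x) : Prop :=
  ContMDiff I I.tangent ∞ fun x => (⟨x, X x⟩ : TangentBundle I M)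

/-- A vector field with support on a subset `S` of a manifold is smooth: near each point of `S` it
is the restriction of a smooth vector field of the manifold. -/
def IsSmoothFieldOn (I : ModelWithCorners ℝ F H) [IsManifold I 1 M] (S : Set M)
    (X : ∀ x : S, TangentSpace I (x : M)) : Prop :=
  ∀ x ∈ S, ∃ U : Set M, IsOpen U ∧ x ∈ U ∧ ∃ Y : ∀ y : M, TangentSpace I y,
    ContMDiffOn I I.tangent ∞ (fun y => (⟨y, Y y⟩ : TangentBundle I M)) U ∧
    ∀ y : S, (y : M) ∈ U → Y y = X y

end Forms

section Mechanics

variable {E : Type*} [NormedAddCommGroup E] [NormedSpace ℝ E]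
  {Q : Type*} [TopologicalSpace Q] [ChartedSpace E Q] [IsManifold 𝓘(ℝ, E) ∞ Q]

/-- The model with corners of `T^k Q`. -/
abbrev jetI (E : Type*) [NormedAddCommGroup E] [NormedSpace ℝ E] (k : ℕ) :
    ModelWithCorners ℝ (JetModel E k) (JetModel E k) := 𝓘(ℝ, JetModel E k)

variable (E Q) in
/-- `1`-forms on `T^k Q`. -/
abbrev JetForm (k : ℕ) : Type _ := ∀ p : Jet E Q k, TangentSpace (jetI E k) p →L[ℝ] ℝ

/-- The pullback of a `1`-form by `ρ^N_m`. -/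
def pullForm {m N : ℕ} (h : m ≤ N) (α : JetForm E Q m) : JetForm E Q N := fun p =>
  (α (p.proj h)).comp (mfderiv (jetI E N) (jetI E m) (Jet.proj h) p)

/-- The canonical map `j_{m+1} : T^N Q → T(T^m Q)`, for `m + 1 ≤ N`; in natural coordinates
`j_{m+1} (q_0, …, q_N) = (q_0, …, q_m; q_1, …, q_{m+1})`. -/
def canonicalInj {m N : ℕ} (h : m + 1 ≤ N) (p : Jet E Q N) :
    TangentSpace (jetI E m) (p.proj (m.le_succ.trans h)) :=
  fun i : Fin (m + 1) => p.coord (chartAt E p.base) ⟨i + 1, by omega⟩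

/-- The `r`-th vertical endomorphism `J_r` of `T(T^k Q)`; in natural coordinates
`J_r = ∑ i, (r + i)! / i! • dq_i ⊗ ∂/∂q_{r+i}`. (The coefficient below vanishes for `i < r`.) -/
def vertEnd {k : ℕ} (r : ℕ) (p : Jet E Q k) :
    TangentSpace (jetI E k) p →L[ℝ] TangentSpace (jetI E k) p :=
  ContinuousLinearMap.pi fun i : Fin (k + 1) =>
    ((i : ℕ).descFactorial r : ℝ) •
      (ContinuousLinearMap.proj ⟨i - r, by omega⟩ : JetModel E k →L[ℝ] E)

/-- The canonical vector field `Δ_r` of `T^k Q` for `r = s + 1`; in natural coordinates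
`Δ_r = ∑ i, (r + i)! / i! • q_{i+1} ∂/∂q_{r+i}`. (The coefficient below vanishes for `i < r`.) -/
def canonicalField {k : ℕ} (s : ℕ) (p : Jet E Q k) : TangentSpace (jetI E k) p :=
  fun i : Fin (k + 1) =>
    ((i : ℕ).descFactorial (s + 1) : ℝ) • p.coord (chartAt E p.base) ⟨i - s, by omega⟩

/-- Tulczyjew's derivation `d_T` on functions:
`(d_T f)(p) = df (j_{k+1} p)`. -/
def dTFun {k : ℕ} (f : Jet E Q k → ℝ) : Jet E Q (k + 1) → ℝ := fun p =>
  mfderiv (jetI E k) 𝓘(ℝ, ℝ) f (p.proj k.le_succ) (canonicalInj le_rfl p)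

/-- Tulczyjew's derivation `d_T = i_T ∘ d + d ∘ i_T` on `1`-forms, where `i_T` is the contraction
with the canonical map `j_{k+1} : T^{k+1} Q → T(T^k Q)`. -/
def dTForm {k : ℕ} (α : JetForm E Q k) : JetForm E Q (k + 1) := fun p =>
  let dα : TangentSpace (jetI E (k + 1)) p →L[ℝ] ℝ :=
    (extDerivOne (jetI E k) α (p.proj k.le_succ) (canonicalInj le_rfl p)).comp
      (mfderiv (jetI E (k + 1)) (jetI E k) (Jet.proj k.le_succ) p)
  let di : TangentSpace (jetI E (k + 1)) p →L[ℝ] ℝ :=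
    mfderiv (jetI E (k + 1)) 𝓘(ℝ, ℝ)
      (fun p' : Jet E Q (k + 1) => α (p'.proj k.le_succ) (canonicalInj le_rfl p')) p
  dα + di

/-- The iterates `d_T^s` on functions. -/
def dTFunIter {k : ℕ} (f : Jet E Q k → ℝ) : (s : ℕ) → Jet E Q (k + s) → ℝ
  | 0 => f
  | s + 1 => dTFun (dTFunIter f s)

/-- The iterates `d_T^s` on `1`-forms. -/
def dTFormIter {k : ℕ} (α : JetForm E Q k) : (s : ℕ) → JetForm E Q (k + s)
  | 0 => α
  | s + 1 => dTForm (dTFormIter α s)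

/-- The vertical differential `d_{J_r} f = i(J_r) df` of a function. -/
def vertDiff {k : ℕ} (r : ℕ) (f : Jet E Q k → ℝ) : JetForm E Q k := fun p =>
  (mfderiv (jetI E k) 𝓘(ℝ, ℝ) f p).comp (vertEnd r p)

/-! From here on `L` is a Lagrangian of order `m + 1`, a function on `T^{m+1} Q`. -/

/-- The Lagrangian `1`-form `θ_L = ∑_{r=1}^{m+1} (-1)^{r-1} / r! • d_T^{r-1} d_{J_r} L` on
`T^{2m+1} Q`; the summation index is `s = r - 1`. -/
def lagrangianForm {m : ℕ} (L : Jet E Q (m + 1) → ℝ) : JetForm E Q (2 * m + 1) := fun p =>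
  ∑ s : Fin (m + 1), ((-1 : ℝ) ^ (s : ℕ) / ((s : ℕ) + 1).factorial) •
    pullForm (m := m + 1 + s) (by omega) (dTFormIter (vertDiff ((s : ℕ) + 1) L) s) p

/-- The Lagrangian energy
`E_L = ∑_{r=1}^{m+1} (-1)^{r-1} / r! • d_T^{r-1} (Δ_r L) - L` on `T^{2m+1} Q`; the summation index
is `s = r - 1`. -/
def energy {m : ℕ} (L : Jet E Q (m + 1) → ℝ) : Jet E Q (2 * m + 1) → ℝ := fun p =>
  ∑ s : Fin (m + 1), ((-1 : ℝ) ^ (s : ℕ) / ((s : ℕ) + 1).factorial) *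
      dTFunIter (fun p' : Jet E Q (m + 1) =>
        mfderiv (jetI E (m + 1)) 𝓘(ℝ, ℝ) L p' (canonicalField s p')) s
        (p.proj (m := m + 1 + s) (by omega)) -
    L (p.proj (by omega))

variable (E Q) in
/-- The fibres of the cotangent bundle of `T^m Q`. -/
abbrev CotangentFibre (m : ℕ) (x : Jet E Q m) : Type _ :=
  TangentSpace (jetI E m) x →L[ℝ] Bundle.Trivial (Jet E Q m) ℝ x

variable (E Q) in
/-- The cotangent bundle `T^*(T^m Q)`. -/
abbrev Cotangent (m : ℕ) : Type _ :=
  Bundle.TotalSpace (JetModel E m →L[ℝ] ℝ) (CotangentFibre E Q m)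

/-- The model with corners of `T^*(T^m Q)`. -/
abbrev cotI (E : Type*) [NormedAddCommGroup E] [NormedSpace ℝ E] (m : ℕ) :=
  (jetI E m).prod 𝓘(ℝ, JetModel E m →L[ℝ] ℝ)

/-- The canonical `1`-form `θ_α (v) = α (Tπ v)` of the cotangent bundle `T^*(T^m Q)`. -/
def canonicalOneForm {m : ℕ} (α : Cotangent E Q m) : TangentSpace (cotI E m) α →L[ℝ] ℝ :=
  (α.2 : TangentSpace (jetI E m) α.1 →L[ℝ] ℝ).comp
    (mfderiv (cotI E m) (jetI E m) (fun β : Cotangent E Q m => β.1) α)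

/-- The canonical symplectic form `ω = -dθ` of `T^*(T^m Q)`. -/
def symplecticForm {m : ℕ} (α : Cotangent E Q m) :
    TangentSpace (cotI E m) α →L[ℝ] TangentSpace (cotI E m) α →L[ℝ] ℝ :=
  -extDerivOne (cotI E m) canonicalOneForm α

/-- A right inverse of `Tρ^N_m` at `p`: in natural coordinates
`(v_0, …, v_m) ↦ (v_0, …, v_m, 0, …, 0)`. -/
def zeroLift {m N : ℕ} (h : m ≤ N) (p : Jet E Q N) :
    TangentSpace (jetI E m) (p.proj h) →L[ℝ] TangentSpace (jetI E N) p :=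
  ContinuousLinearMap.pi fun i : Fin (N + 1) =>
    if hi : (i : ℕ) < m + 1 then
      (ContinuousLinearMap.proj ⟨i, hi⟩ : JetModel E m →L[ℝ] E) else 0

/-- The Legendre-Ostrogradsky map `FL : T^{2m+1} Q → T^*(T^m Q)`, determined by
`θ_L (u) = ⟨FL p, Tρ^{2m+1}_m u⟩` for `u` tangent to `T^{2m+1} Q` at `p`. (As `θ_L` is semibasic,
its value at `u` only depends on `Tρ^{2m+1}_m u`.) -/
def legendre {m : ℕ} (L : Jet E Q (m + 1) → ℝ) (p : Jet E Q (2 * m + 1)) : Cotangent E Q m :=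
  ⟨p.proj (by omega), (lagrangianForm L p).comp (zeroLift (by omega) p)⟩

/-- `L` is hyperregular: the Legendre-Ostrogradsky map is a global diffeomorphism. -/
def Hyperregular {m : ℕ} (L : Jet E Q (m + 1) → ℝ) : Prop :=
  ∃ Φ : Diffeomorph (jetI E (2 * m + 1)) (cotI E m) (Jet E Q (2 * m + 1)) (Cotangent E Q m) ∞,
    ⇑Φ = legendre L

variable (E Q) in
/-- The unified phase space `W = T^{2m+1} Q ×_{T^m Q} T^*(T^m Q)`: the total space of the pullback
of the cotangent bundle by `ρ^{2m+1}_m`. -/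
abbrev Unified (m : ℕ) : Type _ :=
  Bundle.TotalSpace (JetModel E m →L[ℝ] ℝ)
    ((projMap E Q (show m ≤ 2 * m + 1 by omega)) *ᵖ (CotangentFibre E Q m))

/-- The model with corners of `W`. -/
abbrev uniI (E : Type*) [NormedAddCommGroup E] [NormedSpace ℝ E] (m : ℕ) :=
  (jetI E (2 * m + 1)).prod 𝓘(ℝ, JetModel E m →L[ℝ] ℝ)


/-- The projection `pr₁ : W → T^{2m+1} Q`. -/
def pr1 {m : ℕ} (w : Unified E Q m) : Jet E Q (2 * m + 1) := w.1

/-- The projection `pr₂ : W → T^*(T^m Q)`. -/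
def pr2 {m : ℕ} (w : Unified E Q m) : Cotangent E Q m := ⟨w.1.proj (by omega), w.2⟩

/-- The presymplectic form `Ω = pr₂^* ω`. -/
def presymplecticForm {m : ℕ} (w : Unified E Q m) (u v : TangentSpace (uniI E m) w) : ℝ :=
  symplecticForm (pr2 w) (mfderiv (uniI E m) (cotI E m) pr2 w u)
    (mfderiv (uniI E m) (cotI E m) pr2 w v)

/-- The coupling function `C (p, α) = ⟨α, j_{m+1} p⟩`. -/
def coupling {m : ℕ} (w : Unified E Q m) : ℝ :=
  (pr2 w).2 (canonicalInj (by omega) (pr1 w))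

/-- The Hamiltonian function `H = C - (ρ^{2m+1}_{m+1} ∘ pr₁)^* L` of `W`. -/
def unifiedHamiltonian {m : ℕ} (L : Jet E Q (m + 1) → ℝ) (w : Unified E Q m) : ℝ :=
  coupling w - L ((pr1 w).proj (by omega))

/-- The graph parametrization `p ↦ (p, FL p)`. -/
def graphMap {m : ℕ} (L : Jet E Q (m + 1) → ℝ) (p : Jet E Q (2 * m + 1)) : Unified E Q m :=
  ⟨p, (legendre L p).2⟩

/-- The submanifold `W_o = graph FL` of `W`. -/
def Wo {m : ℕ} (L : Jet E Q (m + 1) → ℝ) : Set (Unified E Q m) :=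
  {w | pr2 w = legendre L (pr1 w)}

lemma graphMap_mem {m : ℕ} (L : Jet E Q (m + 1) → ℝ) (p : Jet E Q (2 * m + 1)) :
    graphMap L p ∈ Wo L := rfl

/-- Vector fields of `W` at support on `W_o` (not necessarily smooth). -/
abbrev FieldOnWo {m : ℕ} (L : Jet E Q (m + 1) → ℝ) : Type _ :=
  ∀ w : Wo L, TangentSpace (uniI E m) (w : Unified E Q m)

/-- `X` is tangent to `W_o`: its value at each point is in the tangent space of the graph of `FL`,
which is the range of the derivative of `p ↦ (p, FL p)`. -/
def TangentToWo {m : ℕ} {L : Jet E Q (m + 1) → ℝ} (X : FieldOnWo L) : Prop :=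
  ∀ w : Wo L, ∃ u : TangentSpace (jetI E (2 * m + 1)) (pr1 w.1),
    X w = mfderiv (jetI E (2 * m + 1)) (uniI E m) (graphMap L) (pr1 w.1) u

/-- The dynamical equation `[i(X)Ω - dH]|_{W_o} = 0`. -/
def SolvesUnified {m : ℕ} {L : Jet E Q (m + 1) → ℝ} (X : FieldOnWo L) : Prop :=
  ∀ (w : Wo L) (v : TangentSpace (uniI E m) (w : Unified E Q m)),
    presymplecticForm w.1 (X w) v =
      mfderiv (uniI E m) 𝓘(ℝ, ℝ) (unifiedHamiltonian L) w.1 v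

/-- The vector field `X_L` of `T^{2m+1} Q` with `X_L ∘ pr₁ = Tpr₁ ∘ X` on `W_o`. -/
def lagrangianField {m : ℕ} {L : Jet E Q (m + 1) → ℝ} (X : FieldOnWo L)
    (p : Jet E Q (2 * m + 1)) : TangentSpace (jetI E (2 * m + 1)) p :=
  mfderiv (uniI E m) (jetI E (2 * m + 1)) pr1 (graphMap L p) (X ⟨graphMap L p, graphMap_mem L p⟩)

/-- `Y = FL_* Z`: the vector fields `Z` of `T^{2m+1} Q` and `Y` of `T^*(T^m Q)` are
`FL`-related, `Y ∘ FL = TFL ∘ Z`. -/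
def IsLegendrePushforward {m : ℕ} (L : Jet E Q (m + 1) → ℝ)
    (Z : ∀ p : Jet E Q (2 * m + 1), TangentSpace (jetI E (2 * m + 1)) p)
    (Y : ∀ α : Cotangent E Q m, TangentSpace (cotI E m) α) : Prop :=
  ∀ p, Y (legendre L p) = mfderiv (jetI E (2 * m + 1)) (cotI E m) (legendre L) p (Z p)

/-- Hamilton's equation `i(Y)ω - dh = 0` on `T^*(T^m Q)`. -/
def SolvesHamilton {m : ℕ} (h : Cotangent E Q m → ℝ)
    (Y : ∀ α : Cotangent E Q m, TangentSpace (cotI E m) α) : Prop :=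
  ∀ (α : Cotangent E Q m) (v : TangentSpace (cotI E m) α),
    symplecticForm α (Y α) v = mfderiv (cotI E m) 𝓘(ℝ, ℝ) h α v

end Mechanics
end HigherOrder

end

open HigherOrder

/-! Write `k = m + 1`. The graph parametrization `g = graphMap L` is a section of `pr1`, satisfies
`pr2 ∘ g = FL`, and has image `W_o`. Hence a field tangent to `W_o` is determined by `X_L`: at `g p`
it equals `Tg (X_L p)` (`apply_graphMap_of_tangentToWo`). Two facts about `H` complete the argument.

(a) `H ∘ g = E_L`, that is, `E_L = i_T θ_L - L` (`energy_eq`). Since `E_L = h ∘ FL`, evaluating the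
unified equation on the vectors `Tg u` alone yields `ω(TFL X_L, TFL u) = dh(TFL u)`
(`solvesHamilton_apply`). As `FL` is a diffeomorphism, the vectors `TFL u` fill the tangent spaces
of `T^*(T^m Q)`, so this is Hamilton's equation for `FL_* X_L`. Uniqueness is the nondegeneracy of
`ω`.

(b) `dH` vanishes on `ker Tpr₂` along `W_o` (`mfderiv_unifiedHamiltonian_eq_zero`), because the
highest momentum is `∂L/∂q_{m+1}` (`lagrangianForm_top`). Any `v` tangent to `W` at `g p` has the
same image under `Tpr₂` as some `Tg u`, since `TFL` is onto. Both `i(X)Ω` and `dH` are therefore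
unchanged when `v` is replaced by `Tg u`, and Hamilton's equation implies the unified equation for
the lifted field (`solvesUnified_graphField`).

The formulas for `θ_L` and `E_L` are proved in natural coordinates. Each induces calculations with
`d_T^s` in one fixed chart, whereas the intrinsic objects use the preferred chart of each separate
point, so behaviour under chart changes is needed. It is obtained by representing every coordinate
vector as the jet of a curve: then `j` is `x ↦ x'`, `J_r` is multiplication of a variation by `t^r`,
`Δ_r` is the variation `t^r x'`, and a chart change `τ` acts on variations by `Dτ(x)`
(`fderiv_jetTrans_curveJet`). For `d_T` on `1`-forms, symmetry of second derivatives enters as well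
(`locDTForm_jetTrans`). The identities (a) and (b) then rest on `d_T` raising the order of
semibasicity by one (`locDTFormIter_semibasic`, `locDTFormIter_shift`, `locDTFormIter_top`). -/

noncomputable section

namespace HigherOrder

/-! ### Derivatives at 0 of curves and of families of curves. -/

section CurveCalculus

variable {E F : Type*} [NormedAddCommGroup E] [NormedSpace ℝ E]
  [NormedAddCommGroup F] [NormedSpace ℝ F]

/-- The neighbourhood depends on `n`: smoothness at a single point provides neighbourhoods only for
finite orders. -/
lemma eventually_contDiffAt_nat {f : E → F} {x : E} (hf : ContDiffAt ℝ ∞ f x) (n : ℕ) :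
    ∀ᶠ y in 𝓝 x, ContDiffAt ℝ n f y :=
  (hf.of_le (m := n) (by exact_mod_cast le_top)).eventually (by simp)

lemma contDiffAt_fderiv_infty {f : E → F} {x : E} (hf : ContDiffAt ℝ ∞ f x) :
    ContDiffAt ℝ ∞ (fderiv ℝ f) x :=
  hf.fderiv_right le_rfl

lemma contDiffAt_fderiv_apply_infty {f : E → F} {x : E} (hf : ContDiffAt ℝ ∞ f x) (v : E) :
    ContDiffAt ℝ ∞ (fun y => fderiv ℝ f y v) x :=
  (contDiffAt_fderiv_infty hf).clm_apply contDiffAt_const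

lemma contDiffAt_deriv_infty {f : ℝ → F} {t : ℝ} (hf : ContDiffAt ℝ ∞ f t) :
    ContDiffAt ℝ ∞ (deriv f) t :=
  contDiffAt_fderiv_apply_infty hf 1

lemma iteratedDeriv_id_smul (i : ℕ) {f : ℝ → F} (hf : ContDiffAt ℝ ∞ f 0) :
    iteratedDeriv i (fun t => t • f t) 0 = (i : ℝ) • iteratedDeriv (i - 1) f 0 := by
  induction i generalizing f with
  | zero => simp
  | succ i ih =>
    have hev : deriv (fun t => t • f t) =ᶠ[𝓝 0] fun t => t • deriv f t + f t := by
      filter_upwards [eventually_contDiffAt_nat hf 1] with t ht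
      have h1 := (hasDerivAt_id t).fun_smul (ht.differentiableAt (by simp)).hasDerivAt
      simpa using h1.deriv
    have hd := contDiffAt_deriv_infty hf
    have hd' : ContDiffAt ℝ ∞ (fun t => t • deriv f t) 0 := contDiffAt_id.smul hd
    rw [iteratedDeriv_succ', hev.iteratedDeriv_eq,
      iteratedDeriv_fun_add (hd'.of_le (by exact_mod_cast le_top))
        (hf.of_le (by exact_mod_cast le_top)), ih hd]
    rcases i with _ | i
    · simp
    · rw [Nat.add_sub_cancel, Nat.add_sub_cancel, ← iteratedDeriv_succ']
      push_cast
      rw [add_smul (_ + _) (1 : ℝ), one_smul]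

/-- In the Leibniz rule at 0 only the terms that differentiate all `r` factors `t` survive. This is
where the coefficients of `J_r` and `Δ_r` come from. -/
lemma iteratedDeriv_pow_smul (r i : ℕ) {f : ℝ → F} (hf : ContDiffAt ℝ ∞ f 0) :
    iteratedDeriv i (fun t => t ^ r • f t) 0 =
      (i.descFactorial r : ℝ) • iteratedDeriv (i - r) f 0 := by
  induction r generalizing i with
  | zero => simp
  | succ r ih =>
    have h1 : (fun t : ℝ => t ^ (r + 1) • f t) = fun t => t • (t ^ r • f t) := by
      funext t; rw [smul_smul, pow_succ']
    have h2 : ContDiffAt ℝ ∞ (fun t : ℝ => t ^ r • f t) 0 := (contDiffAt_id.pow r).smul hf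
    rw [h1, iteratedDeriv_id_smul i h2, ih, smul_smul]
    rcases i with _ | i
    · simp
    · rw [Nat.succ_descFactorial_succ, Nat.add_sub_cancel, Nat.add_sub_add_right]
      push_cast
      rfl

lemma hasDerivAt_slice_fst {G : ℝ × ℝ → F} {s t : ℝ} (hG : DifferentiableAt ℝ G (s, t)) :
    HasDerivAt (fun s' => G (s', t)) (fderiv ℝ G (s, t) (1, 0)) s :=
  hG.hasFDerivAt.comp_hasDerivAt s ((hasDerivAt_id s).prodMk (hasDerivAt_const s t))

lemma hasDerivAt_slice_snd {G : ℝ × ℝ → F} {s t : ℝ} (hG : DifferentiableAt ℝ G (s, t)) :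
    HasDerivAt (fun t' => G (s, t')) (fderiv ℝ G (s, t) (0, 1)) t :=
  hG.hasFDerivAt.comp_hasDerivAt t ((hasDerivAt_const t s).prodMk (hasDerivAt_id t))

/-- Differentiation with respect to a parameter commutes with iterated derivatives. -/
lemma hasDerivAt_iteratedDeriv_param (i : ℕ) {G : ℝ × ℝ → F} (hG : ContDiffAt ℝ ∞ G (0, 0)) :
    HasDerivAt (fun s => iteratedDeriv i (fun t => G (s, t)) 0)
      (iteratedDeriv i (fun t => fderiv ℝ G (0, t) (1, 0)) 0) 0 := by
  induction i generalizing G with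
  | zero =>
    simpa using hasDerivAt_slice_fst (hG.differentiableAt (by simp))
  | succ i ih =>
    -- The induction hypothesis is applied to `∂G/∂t`; what remains is the equality of the mixed
    -- partial derivatives near `(0, 0)`.
    have hG' := contDiffAt_fderiv_apply_infty hG (0, 1)
    have h1 := ih hG'
    have hdiff : ∀ᶠ z in 𝓝 ((0 : ℝ), (0 : ℝ)), ContDiffAt ℝ 2 G z :=
      eventually_contDiffAt_nat hG 2
    have hs : (fun s => iteratedDeriv (i + 1) (fun t => G (s, t)) 0) =ᶠ[𝓝 0]
        fun s => iteratedDeriv i (fun t => fderiv ℝ G (s, t) (0, 1)) 0 := by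
      rw [nhds_prod_eq] at hdiff
      filter_upwards [hdiff.curry] with s hs
      rw [iteratedDeriv_succ']
      refine Filter.EventuallyEq.iteratedDeriv_eq i ?_
      filter_upwards [hs] with t ht
      exact (hasDerivAt_slice_snd (ht.differentiableAt (by simp))).deriv
    refine (h1.congr_of_eventuallyEq hs).congr_deriv ?_
    rw [iteratedDeriv_succ']
    refine Filter.EventuallyEq.iteratedDeriv_eq i ?_
    have hc : Filter.Tendsto (fun t : ℝ => ((0 : ℝ), t)) (𝓝 0) (𝓝 (0, 0)) :=
      Continuous.tendsto' (by fun_prop) _ _ rfl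
    filter_upwards [hc.eventually hdiff] with t ht
    have hd : DifferentiableAt ℝ (fderiv ℝ G) (0, t) :=
      (ht.fderiv_right (m := 1) (by norm_num)).differentiableAt (by simp)
    have hsymm := ht.isSymmSndFDerivAt (by simp)
    have e1 : fderiv ℝ (fun z => fderiv ℝ G z (0, 1)) (0, t) (1, 0) =
        fderiv ℝ (fderiv ℝ G) (0, t) (1, 0) (0, 1) := by
      rw [fderiv_clm_apply hd (by fun_prop)]; simp
    have e2 : fderiv ℝ (fun z => fderiv ℝ G z (1, 0)) (0, t) (0, 1) =
        fderiv ℝ (fderiv ℝ G) (0, t) (0, 1) (1, 0) := by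
      rw [fderiv_clm_apply hd (by fun_prop)]; simp
    rw [e1, (hasDerivAt_slice_snd (G := fun z => fderiv ℝ G z (1, 0)) (s := 0) (t := t)
      (hd.clm_apply (by fun_prop))).deriv, e2]
    exact hsymm _ _

lemma contDiffAt_pow_smul (r : ℕ) {y : ℝ → E} (hy : ContDiffAt ℝ ∞ y 0) :
    ContDiffAt ℝ ∞ (fun t : ℝ => t ^ r • y t) 0 :=
  (contDiffAt_id.pow r).smul hy

/-- The `k`-jet at `0` of a curve in a vector space. -/
def curveJet (k : ℕ) (x : ℝ → E) : JetModel E k := fun i => iteratedDeriv i x 0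

lemma curveJet_taylorCurve {k : ℕ} (q : JetModel E k) : curveJet k (taylorCurve q) = q :=
  funext fun i => iteratedDeriv_taylorCurve q i

lemma curveJet_add_smul (k : ℕ) {x y : ℝ → E} (hx : ContDiffAt ℝ ∞ x 0) (hy : ContDiffAt ℝ ∞ y 0)
    (s : ℝ) : curveJet k (fun t => x t + s • y t) = curveJet k x + s • curveJet k y := by
  funext i
  have hy' : ContDiffAt ℝ ∞ (fun t => s • y t) 0 := contDiffAt_const.smul hy
  simp only [curveJet, Pi.add_apply, Pi.smul_apply]
  rw [iteratedDeriv_fun_add (hx.of_le (by exact_mod_cast le_top))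
    (hy'.of_le (by exact_mod_cast le_top)), iteratedDeriv_fun_const_smul_field]

end CurveCalculus

/-! ### Projections, shifts, `J_r` and `Δ_r` in coordinates and on jets of curves. -/

section CoordinateMaps

variable {E : Type*} [NormedAddCommGroup E] [NormedSpace ℝ E]

variable (E) in
/-- The coordinate expression `(q_0, …, q_N) ↦ (q_0, …, q_m)` of `ρ^N_m`. -/
def truncL {m N : ℕ} (h : m ≤ N) : JetModel E N →L[ℝ] JetModel E m :=
  ContinuousLinearMap.pi fun i => ContinuousLinearMap.proj (Fin.castLE (by omega) i)

variable (E) in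
/-- The map `(q_0, …, q_N) ↦ (q_1, …, q_{m+1})`, the fibre part of the canonical map `j_{m+1}`. -/
def shiftL {m N : ℕ} (h : m + 1 ≤ N) : JetModel E N →L[ℝ] JetModel E m :=
  ContinuousLinearMap.pi fun i => ContinuousLinearMap.proj ⟨i + 1, by omega⟩

variable (E) in
/-- The coordinate expression of the vertical endomorphism `J_r`. -/
def vertL (k r : ℕ) : JetModel E k →L[ℝ] JetModel E k :=
  ContinuousLinearMap.pi fun i : Fin (k + 1) =>
    ((i : ℕ).descFactorial r : ℝ) •
      (ContinuousLinearMap.proj ⟨i - r, by omega⟩ : JetModel E k →L[ℝ] E)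

variable (E) in
/-- The coordinate expression of the canonical vector field `Δ_{s+1}`. -/
def deltaL (k s : ℕ) : JetModel E k →L[ℝ] JetModel E k :=
  ContinuousLinearMap.pi fun i : Fin (k + 1) =>
    ((i : ℕ).descFactorial (s + 1) : ℝ) •
      (ContinuousLinearMap.proj ⟨i - s, by omega⟩ : JetModel E k →L[ℝ] E)

@[simp] lemma truncL_apply {m N : ℕ} (h : m ≤ N) (q : JetModel E N) (i : Fin (m + 1)) :
    truncL E h q i = q ⟨i, by omega⟩ := rfl

@[simp] lemma shiftL_apply {m N : ℕ} (h : m + 1 ≤ N) (q : JetModel E N) (i : Fin (m + 1)) :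
    shiftL E h q i = q ⟨i + 1, by omega⟩ := rfl

@[simp] lemma vertL_apply {k r : ℕ} (q : JetModel E k) (i : Fin (k + 1)) :
    vertL E k r q i = ((i : ℕ).descFactorial r : ℝ) • q ⟨i - r, by omega⟩ := rfl

@[simp] lemma deltaL_apply {k s : ℕ} (q : JetModel E k) (i : Fin (k + 1)) :
    deltaL E k s q i = ((i : ℕ).descFactorial (s + 1) : ℝ) • q ⟨i - s, by omega⟩ := rfl

lemma truncL_curveJet {m N : ℕ} (h : m ≤ N) (x : ℝ → E) :
    truncL E h (curveJet N x) = curveJet m x := rfl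

lemma shiftL_curveJet {m N : ℕ} (h : m + 1 ≤ N) (x : ℝ → E) :
    shiftL E h (curveJet N x) = curveJet m (deriv x) := by
  funext i
  simp [curveJet, iteratedDeriv_succ']

lemma vertL_curveJet (k r : ℕ) {x : ℝ → E} (hx : ContDiffAt ℝ ∞ x 0) :
    vertL E k r (curveJet k x) = curveJet k (fun t => t ^ r • x t) := by
  funext i
  simp [curveJet, iteratedDeriv_pow_smul r i hx]

/-- For `i < s + 1` both coefficients vanish; beyond that `i - (s + 1) + 1 = i - s`, the extra
derivative being that in `x'`. -/
lemma deltaL_curveJet (k s : ℕ) {x : ℝ → E} (hx : ContDiffAt ℝ ∞ x 0) :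
    deltaL E k s (curveJet k x) = curveJet k (fun t => t ^ (s + 1) • deriv x t) := by
  funext i
  simp only [curveJet, deltaL_apply]
  rw [iteratedDeriv_pow_smul (s + 1) i (contDiffAt_deriv_infty hx)]
  rcases lt_or_ge (i : ℕ) (s + 1) with h | h
  · rw [Nat.descFactorial_of_lt h]; simp
  · rw [← iteratedDeriv_succ', show (i : ℕ) - (s + 1) + 1 = i - s by omega]

end CoordinateMaps

/-! ### Changes of natural coordinates and their action on tangent vectors. -/

section Transition

variable {E : Type*} [NormedAddCommGroup E] [NormedSpace ℝ E]
  {Q : Type*} [TopologicalSpace Q] [ChartedSpace E Q] [IsManifold 𝓘(ℝ, E) ∞ Q]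

/-- The change of natural coordinates of `T^k Q` induced by two charts of `Q`. -/
def jetTrans (k : ℕ) (e e' : atlas E Q) (q : JetModel E k) : JetModel E k :=
  jetChart k e' ((jetChart k e).symm q)

/-- The domain of the change of natural coordinates. -/
def transDomain (k : ℕ) (e e' : atlas E Q) : Set (JetModel E k) :=
  {q | q 0 ∈ e.1.target ∧ e.1.symm (q 0) ∈ e'.1.source}

variable {e e' : atlas E Q}

lemma transDomain_eq (k : ℕ) : transDomain k e e' =
    ((jetChart k e).symm.trans (jetChart k e')).source := by
  rw [jetChart_trans_source]; ext q; simp [transDomain]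

lemma isOpen_transDomain (k : ℕ) : IsOpen (transDomain k e e') := by
  rw [transDomain_eq, jetChart_trans_source]
  exact (e.1.symm.trans e'.1).open_source.preimage (continuous_apply 0)

lemma contDiffAt_jetTrans {k : ℕ} {q : JetModel E k} (hq : q ∈ transDomain k e e') :
    ContDiffAt ℝ ∞ (jetTrans k e e') q := by
  have h := contDiffOn_jetChart_transition k e e'
  rw [← transDomain_eq] at h
  exact (h q hq).contDiffAt ((isOpen_transDomain k).mem_nhds hq)

/-- Both sides are the Faà di Bruno formula for the derivatives of `τ ∘ x`. -/
lemma jetTrans_curveJet {k : ℕ} {x : ℝ → E} (hx : ContDiffAt ℝ ∞ x 0)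
    (h : x 0 ∈ e.1.target) (h' : e.1.symm (x 0) ∈ e'.1.source) :
    jetTrans k e e' (curveJet k x) = curveJet k ((e'.1 ∘ e.1.symm) ∘ x) := by
  have h0 : curveJet k x 0 = x 0 := by simp [curveJet]
  funext i
  rw [jetTrans, jetChart_transition k e e' (by rwa [h0]) (by rwa [h0]) i, h0]
  exact (iteratedDeriv_vcomp_eq_sum_orderedFinpartition (n := ∞)
    (contDiffAt_transition e.2 e'.2 h h') hx (by exact_mod_cast le_top)).symm

/-- A tangent vector to a jet space is the jet of a variation along a curve, and a chart change `τ`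
acts on it pointwise in `t` through `Dτ`. All the equivariance statements for `j`, `J_r` and `Δ_r`
follow from this. -/
lemma fderiv_jetTrans_curveJet {k : ℕ} {x y : ℝ → E} (hx : ContDiffAt ℝ ∞ x 0)
    (hy : ContDiffAt ℝ ∞ y 0) (h : x 0 ∈ e.1.target) (h' : e.1.symm (x 0) ∈ e'.1.source) :
    fderiv ℝ (jetTrans k e e') (curveJet k x) (curveJet k y) =
      curveJet k (fun t => fderiv ℝ (e'.1 ∘ e.1.symm) (x t) (y t)) := by
  have h0 : curveJet k x 0 = x 0 := by simp [curveJet]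
  have hmem : curveJet k x ∈ transDomain k e e' := by
    rw [← h0] at h h'; exact ⟨h, h'⟩
  have hτ := contDiffAt_transition e.2 e'.2 h h'
  set τ := e'.1 ∘ e.1.symm
  -- By linearity of jets, the straight line from `curveJet k x` in direction `curveJet k y`
  -- consists of the jets of the curves `g (s, ·)`. Its image is differentiated at `s = 0` in two
  -- ways.
  let g : ℝ × ℝ → E := fun z => x z.2 + z.1 • y z.2
  have hg : ContDiffAt ℝ ∞ g (0, 0) := by
    have h1 : ContDiffAt ℝ ∞ (fun z : ℝ × ℝ => x z.2) (0, 0) :=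
      ContDiffAt.comp (g := x) (0, 0) hx contDiffAt_snd
    have h2 : ContDiffAt ℝ ∞ (fun z : ℝ × ℝ => y z.2) (0, 0) :=
      ContDiffAt.comp (g := y) (0, 0) hy contDiffAt_snd
    exact h1.add (contDiffAt_fst.smul h2)
  have hg0 : g (0, 0) = x 0 := by simp [g]
  have hG : ContDiffAt ℝ ∞ (τ ∘ g) (0, 0) := ContDiffAt.comp (0, 0) (by rwa [hg0]) hg
  -- the derivative of the curve `s ↦ jetTrans (curveJet x + s • curveJet y)`
  have hline : HasDerivAt (fun s : ℝ => jetTrans k e e' (curveJet k x + s • curveJet k y))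
      (fderiv ℝ (jetTrans k e e') (curveJet k x) (curveJet k y)) 0 := by
    have hd : HasFDerivAt (jetTrans k e e') (fderiv ℝ (jetTrans k e e') (curveJet k x))
        (curveJet k x + (0 : ℝ) • curveJet k y) := by
      rw [zero_smul, add_zero]
      exact ((contDiffAt_jetTrans hmem).differentiableAt (by simp)).hasFDerivAt
    have hl : HasDerivAt (fun s : ℝ => curveJet k x + s • curveJet k y) (curveJet k y) 0 := by
      simpa using ((hasDerivAt_id (0 : ℝ)).smul_const (curveJet k y)).const_add (curveJet k x)
    exact HasFDerivAt.comp_hasDerivAt (f := fun s : ℝ => curveJet k x + s • curveJet k y) 0 hd hl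
  -- For small `s` the initial point of the varied curve remains in the overlap of the charts.
  have hopen : ∀ᶠ s : ℝ in 𝓝 0, x 0 + s • y 0 ∈ e.1.target ∧
      e.1.symm (x 0 + s • y 0) ∈ e'.1.source := by
    have hc : Filter.Tendsto (fun s : ℝ => x 0 + s • y 0) (𝓝 0) (𝓝 (x 0)) :=
      Continuous.tendsto' (by fun_prop) _ _ (by simp)
    have ho := hc.eventually ((e.1.symm.trans e'.1).open_source.mem_nhds
      (show x 0 ∈ _ by simpa using ⟨h, h'⟩))
    filter_upwards [ho] with s hs
    rw [OpenPartialHomeomorph.trans_source] at hs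
    exact hs
  refine hline.unique ?_
  rw [hasDerivAt_pi]
  intro i
  have hp := hasDerivAt_iteratedDeriv_param i hG
  refine (hp.congr_of_eventuallyEq ?_).congr_deriv ?_
  · filter_upwards [hopen] with s hs
    have hxy : ContDiffAt ℝ ∞ (fun t => x t + s • y t) 0 := hx.add (contDiffAt_const.smul hy)
    rw [← curveJet_add_smul k hx hy s, jetTrans_curveJet hxy hs.1 hs.2]
    rfl
  · refine Filter.EventuallyEq.iteratedDeriv_eq i ?_
    have hx1 : ∀ᶠ t in 𝓝 (0 : ℝ), DifferentiableAt ℝ τ (x t) := by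
      filter_upwards [hx.continuousAt.eventually (eventually_contDiffAt_nat hτ 1)] with t ht
      exact ht.differentiableAt (by simp)
    have hc : Filter.Tendsto (fun t : ℝ => ((0 : ℝ), t)) (𝓝 0) (𝓝 (0, 0)) :=
      Continuous.tendsto' (by fun_prop) _ _ rfl
    filter_upwards [hx1, hc.eventually (eventually_contDiffAt_nat hG 1)] with t ht hGt
    refine (hasDerivAt_slice_fst (hGt.differentiableAt (by simp))).unique ?_
    have hgt : HasDerivAt (fun s : ℝ => x t + s • y t) (y t) 0 := by
      simpa using ((hasDerivAt_id (0 : ℝ)).smul_const (y t)).const_add (x t)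
    have : HasFDerivAt τ (fderiv ℝ τ (x t)) (x t + (0 : ℝ) • y t) := by
      simpa using ht.hasFDerivAt
    exact this.comp_hasDerivAt 0 hgt

lemma contDiffAt_fderiv_curve {x y : ℝ → E} (hx : ContDiffAt ℝ ∞ x 0)
    (hy : ContDiffAt ℝ ∞ y 0) (h : x 0 ∈ e.1.target) (h' : e.1.symm (x 0) ∈ e'.1.source) :
    ContDiffAt ℝ ∞ (fun t => fderiv ℝ (e'.1 ∘ e.1.symm) (x t) (y t)) 0 :=
  ((contDiffAt_fderiv_infty (contDiffAt_transition e.2 e'.2 h h')).comp 0 hx).clm_apply hy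

lemma deriv_transition_comp {x : ℝ → E} (hx : ContDiffAt ℝ ∞ x 0)
    (h : x 0 ∈ e.1.target) (h' : e.1.symm (x 0) ∈ e'.1.source) :
    deriv ((e'.1 ∘ e.1.symm) ∘ x) =ᶠ[𝓝 0]
      fun t => fderiv ℝ (e'.1 ∘ e.1.symm) (x t) (deriv x t) := by
  filter_upwards [eventually_contDiffAt_nat hx 1, hx.continuousAt.eventually
    (eventually_contDiffAt_nat (contDiffAt_transition e.2 e'.2 h h') 1)] with t ht hτ
  exact ((hτ.differentiableAt (by simp)).hasFDerivAt.comp_hasDerivAt t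
    (ht.differentiableAt (by simp)).hasDerivAt).deriv

lemma curveJet_congr {k : ℕ} {x y : ℝ → E} (h : x =ᶠ[𝓝 0] y) : curveJet k x = curveJet k y :=
  funext fun i => h.iteratedDeriv_eq i

/-- Taylor polynomials realize all coordinate vectors, which reduces identities between coordinate
expressions to identities between curves. -/
lemma exists_curveJet {k : ℕ} (q : JetModel E k) :
    ∃ x : ℝ → E, ContDiffAt ℝ ∞ x 0 ∧ x 0 = q 0 ∧ curveJet k x = q :=
  ⟨_, (contDiff_taylorCurve q).contDiffAt, taylorCurve_zero q, curveJet_taylorCurve q⟩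

lemma truncL_jetTrans {m N : ℕ} (h : m ≤ N) {q : JetModel E N} (hq : q ∈ transDomain N e e') :
    truncL E h (jetTrans N e e' q) = jetTrans m e e' (truncL E h q) := by
  obtain ⟨x, hx, hx0, rfl⟩ := exists_curveJet q
  rw [transDomain, Set.mem_ofPred_eq, ← hx0] at hq
  rw [truncL_curveJet, jetTrans_curveJet hx hq.1 hq.2, jetTrans_curveJet hx hq.1 hq.2,
    truncL_curveJet]

lemma fderiv_jetTrans_trunc {m N : ℕ} (h : m ≤ N) {q : JetModel E N}
    (hq : q ∈ transDomain N e e') (v : JetModel E N) :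
    fderiv ℝ (jetTrans m e e') (truncL E h q) (truncL E h v) =
      truncL E h (fderiv ℝ (jetTrans N e e') q v) := by
  obtain ⟨x, hx, hx0, rfl⟩ := exists_curveJet q
  obtain ⟨y, hy, -, rfl⟩ := exists_curveJet v
  rw [transDomain, Set.mem_ofPred_eq, ← hx0] at hq
  rw [truncL_curveJet, truncL_curveJet, fderiv_jetTrans_curveJet hx hy hq.1 hq.2,
    fderiv_jetTrans_curveJet hx hy hq.1 hq.2, truncL_curveJet]

/-- The chain rule `(τ ∘ x)' = Dτ(x) x'`, read on jets: the canonical map `j` does not depend on the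
chart. -/
lemma fderiv_jetTrans_shift {m N : ℕ} (h : m + 1 ≤ N) {q : JetModel E N}
    (hq : q ∈ transDomain N e e') :
    fderiv ℝ (jetTrans m e e') (truncL E (m.le_succ.trans h) q) (shiftL E h q) =
      shiftL E h (jetTrans N e e' q) := by
  obtain ⟨x, hx, hx0, rfl⟩ := exists_curveJet q
  rw [transDomain, Set.mem_ofPred_eq, ← hx0] at hq
  rw [truncL_curveJet, shiftL_curveJet,
    fderiv_jetTrans_curveJet hx (contDiffAt_deriv_infty hx) hq.1 hq.2,
    jetTrans_curveJet hx hq.1 hq.2, shiftL_curveJet,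
    curveJet_congr (deriv_transition_comp hx hq.1 hq.2)]

/-- Multiplication by `t^r` commutes with the linear maps `Dτ(x t)`. -/
lemma fderiv_jetTrans_vertL {k : ℕ} (r : ℕ) {q : JetModel E k} (hq : q ∈ transDomain k e e')
    (v : JetModel E k) :
    fderiv ℝ (jetTrans k e e') q (vertL E k r v) =
      vertL E k r (fderiv ℝ (jetTrans k e e') q v) := by
  obtain ⟨x, hx, hx0, rfl⟩ := exists_curveJet q
  obtain ⟨y, hy, -, rfl⟩ := exists_curveJet v
  rw [transDomain, Set.mem_ofPred_eq, ← hx0] at hq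
  rw [vertL_curveJet k r hy, fderiv_jetTrans_curveJet hx (contDiffAt_pow_smul r hy) hq.1 hq.2,
    fderiv_jetTrans_curveJet hx hy hq.1 hq.2,
    vertL_curveJet k r (contDiffAt_fderiv_curve hx hy hq.1 hq.2)]
  simp

lemma fderiv_jetTrans_deltaL {k : ℕ} (s : ℕ) {q : JetModel E k} (hq : q ∈ transDomain k e e') :
    fderiv ℝ (jetTrans k e e') q (deltaL E k s q) = deltaL E k s (jetTrans k e e' q) := by
  obtain ⟨x, hx, hx0, rfl⟩ := exists_curveJet q
  rw [transDomain, Set.mem_ofPred_eq, ← hx0] at hq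
  have hy := contDiffAt_deriv_infty hx
  have hτx : ContDiffAt ℝ ∞ ((e'.1 ∘ e.1.symm) ∘ x) 0 :=
    (contDiffAt_transition e.2 e'.2 hq.1 hq.2).comp 0 hx
  rw [deltaL_curveJet k s hx, jetTrans_curveJet hx hq.1 hq.2, deltaL_curveJet k s hτx,
    fderiv_jetTrans_curveJet hx (contDiffAt_pow_smul (s + 1) hy) hq.1 hq.2]
  refine curveJet_congr ?_
  filter_upwards [deriv_transition_comp hx hq.1 hq.2] with t ht
  simp [ht]

lemma jetTrans_zero {k : ℕ} {q : JetModel E k} (hq : q ∈ transDomain k e e') :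
    jetTrans k e e' q 0 = e'.1 (e.1.symm (q 0)) := by
  obtain ⟨x, hx, hx0, rfl⟩ := exists_curveJet q
  rw [transDomain, Set.mem_ofPred_eq, ← hx0] at hq
  rw [jetTrans_curveJet hx hq.1 hq.2, ← hx0]
  simp [curveJet]

lemma jetTrans_mem {k : ℕ} {q : JetModel E k} (hq : q ∈ transDomain k e e') :
    jetTrans k e e' q ∈ transDomain k e' e := by
  rw [transDomain, Set.mem_ofPred_eq, jetTrans_zero hq]
  exact ⟨e'.1.map_source hq.2, by rw [e'.1.left_inv hq.2]; exact e.1.map_target hq.1⟩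

end Transition

/-! ### Tulczyjew's derivation in a fixed chart, and semibasic forms. -/

section LocalTulczyjew

variable {E : Type*} [NormedAddCommGroup E] [NormedSpace ℝ E]

/-- The points of `E^{k+1}` with first component in a set. -/
def cyl (k : ℕ) (S : Set E) : Set (JetModel E k) := {q | q 0 ∈ S}

omit [NormedSpace ℝ E] in
lemma isOpen_cyl (k : ℕ) {S : Set E} (hS : IsOpen S) : IsOpen (cyl k S) :=
  hS.preimage (continuous_apply 0)

/-- The coordinate expression of `d_T` on functions. -/
def locDTFun {k : ℕ} (f : JetModel E k → ℝ) : JetModel E (k + 1) → ℝ := fun q =>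
  fderiv ℝ f (truncL E k.le_succ q) (shiftL E le_rfl q)

/-- The coordinate expression of `d_T` on `1`-forms. -/
def locDTForm {k : ℕ} (a : JetModel E k → JetModel E k →L[ℝ] ℝ) :
    JetModel E (k + 1) → JetModel E (k + 1) →L[ℝ] ℝ := fun q =>
  (fderiv ℝ a (truncL E k.le_succ q) (shiftL E le_rfl q)).comp (truncL E k.le_succ) +
    (a (truncL E k.le_succ q)).comp (shiftL E le_rfl)

/-- The iterates of `locDTFun`. -/
def locDTFunIter {k : ℕ} (f : JetModel E k → ℝ) : (s : ℕ) → JetModel E (k + s) → ℝ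
  | 0 => f
  | s + 1 => locDTFun (locDTFunIter f s)

/-- The iterates of `locDTForm`. -/
def locDTFormIter {k : ℕ} (a : JetModel E k → JetModel E k →L[ℝ] ℝ) :
    (s : ℕ) → JetModel E (k + s) → JetModel E (k + s) →L[ℝ] ℝ
  | 0 => a
  | s + 1 => locDTForm (locDTFormIter a s)

lemma locDTForm_apply {k : ℕ} (a : JetModel E k → JetModel E k →L[ℝ] ℝ)
    (q v : JetModel E (k + 1)) :
    locDTForm a q v = fderiv ℝ a (truncL E k.le_succ q) (shiftL E le_rfl q)
      (truncL E k.le_succ v) + a (truncL E k.le_succ q) (shiftL E le_rfl v) := rfl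

lemma contDiffAt_locDTFun {k : ℕ} {f : JetModel E k → ℝ} {q : JetModel E (k + 1)}
    (hf : ContDiffAt ℝ ∞ f (truncL E k.le_succ q)) : ContDiffAt ℝ ∞ (locDTFun f) q := by
  have h : ContDiffAt ℝ ∞ (fun q : JetModel E (k + 1) => fderiv ℝ f (truncL E k.le_succ q)) q :=
    (contDiffAt_fderiv_infty hf).comp q (truncL E k.le_succ).contDiff.contDiffAt
  exact h.clm_apply (shiftL E le_rfl).contDiff.contDiffAt

lemma contDiffAt_locDTForm {k : ℕ} {a : JetModel E k → JetModel E k →L[ℝ] ℝ}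
    {q : JetModel E (k + 1)} (ha : ContDiffAt ℝ ∞ a (truncL E k.le_succ q)) :
    ContDiffAt ℝ ∞ (locDTForm a) q := by
  have h : ContDiffAt ℝ ∞ (fun q : JetModel E (k + 1) => fderiv ℝ a (truncL E k.le_succ q)) q :=
    (contDiffAt_fderiv_infty ha).comp q (truncL E k.le_succ).contDiff.contDiffAt
  have h1 := (h.clm_apply (shiftL E le_rfl).contDiff.contDiffAt).clm_comp
    (contDiffAt_const (c := truncL E k.le_succ))
  have h2 : ContDiffAt ℝ ∞ (fun q : JetModel E (k + 1) => a (truncL E k.le_succ q)) q :=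
    ha.comp q (truncL E k.le_succ).contDiff.contDiffAt
  exact h1.add (h2.clm_comp (contDiffAt_const (c := shiftL E le_rfl)))

variable {S : Set E}

lemma contDiffAt_locDTFormIter {k : ℕ} {a : JetModel E k → JetModel E k →L[ℝ] ℝ}
    (ha : ∀ q ∈ cyl k S, ContDiffAt ℝ ∞ a q) (s : ℕ) :
    ∀ q ∈ cyl (k + s) S, ContDiffAt ℝ ∞ (locDTFormIter a s) q := by
  induction s with
  | zero => exact ha
  | succ s ih => exact fun q hq => contDiffAt_locDTForm (ih _ hq)

lemma fderiv_apply_const_eq_zero {k : ℕ} {a : JetModel E k → JetModel E k →L[ℝ] ℝ}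
    {q : JetModel E k} (ha : ContDiffAt ℝ ∞ a q) {v : JetModel E k}
    (hv : ∀ᶠ q' in 𝓝 q, a q' v = 0) (w : JetModel E k) : fderiv ℝ a q w v = 0 := by
  have hd := ha.differentiableAt (by simp)
  have h1 : fderiv ℝ (fun q' => a q' v) q = 0 := by
    have : (fun q' => a q' v) =ᶠ[𝓝 q] fun _ => (0 : ℝ) := hv
    rw [this.fderiv_eq]; simp
  have h2 : fderiv ℝ (fun q' => a q' v) q w = fderiv ℝ a q w v := by
    rw [fderiv_clm_apply hd (by fun_prop)]; simp
  rw [← h2, h1]; rfl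

/-- If `a` annihilates the vectors whose components of index `< c` vanish (`a` is semibasic over
`T^{c-1}`), then `d_T^s a` annihilates the vectors whose components of index `< c + s` vanish. -/
lemma locDTFormIter_semibasic {k c : ℕ} {a : JetModel E k → JetModel E k →L[ℝ] ℝ} (hS : IsOpen S)
    (ha : ∀ q ∈ cyl k S, ContDiffAt ℝ ∞ a q)
    (h0 : ∀ q ∈ cyl k S, ∀ v : JetModel E k, (∀ i : Fin (k + 1), (i : ℕ) < c → v i = 0) →
      a q v = 0) (s : ℕ) :
    ∀ q ∈ cyl (k + s) S, ∀ v : JetModel E (k + s),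
      (∀ i : Fin (k + s + 1), (i : ℕ) < c + s → v i = 0) →
      locDTFormIter a s q v = 0 := by
  induction s with
  | zero => exact h0
  | succ s ih =>
    intro q hq v hv
    have hq' : truncL E (k + s).le_succ q ∈ cyl (k + s) S := hq
    change locDTForm (locDTFormIter a s) q v = 0
    -- The first term differentiates `q' ↦ a q' v'` with `v'` fixed, which vanishes on a
    -- neighbourhood. In the second, the shift lowers indices by one, so vanishing below `c + s + 1`
    -- becomes vanishing below `c + s`.
    rw [locDTForm_apply, fderiv_apply_const_eq_zero (contDiffAt_locDTFormIter ha s _ hq') ?_,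
      ih _ hq' _ ?_, add_zero]
    · intro i hi
      exact hv _ (by simp; omega)
    · filter_upwards [(isOpen_cyl _ hS).mem_nhds hq'] with q' hq''
      exact ih q' hq'' _ fun i hi => hv _ (by simp; omega)

/-- `i_T` commutes with `d_T` on semibasic forms. -/
lemma locDTFormIter_shift {k c : ℕ} {a : JetModel E k → JetModel E k →L[ℝ] ℝ}
    {f : JetModel E k → ℝ} (hS : IsOpen S)
    (ha : ∀ q ∈ cyl k S, ContDiffAt ℝ ∞ a q)
    (h0 : ∀ q ∈ cyl k S, ∀ v : JetModel E k, (∀ i : Fin (k + 1), (i : ℕ) < c → v i = 0) →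
      a q v = 0)
    (hf : ∀ q ∈ cyl k S, ∀ w : JetModel E k,
      (∀ (i : Fin (k + 1)) (hi : (i : ℕ) < k), (i : ℕ) < c → w i = q ⟨i + 1, by omega⟩) →
      a q w = f q)
    (hc : c ≤ k) (s : ℕ) :
    ∀ q ∈ cyl (k + s) S, ∀ w : JetModel E (k + s),
      (∀ (i : Fin (k + s + 1)) (hi : (i : ℕ) < k + s), (i : ℕ) < c + s →
        w i = q ⟨i + 1, by omega⟩) →
      locDTFormIter a s q w = locDTFunIter f s q := by
  induction s with
  | zero => exact hf
  | succ s ih =>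
    intro q hq w hw
    -- `W` replaces the shift by a map that stays in order `k + s`. Its top slot would need
    -- `q_{k+s+1}` and is set to 0; this does no harm, since the form depends only on slots below `c
    -- + s ≤ k + s`.
    let W : JetModel E (k + s) →L[ℝ] JetModel E (k + s) :=
      ContinuousLinearMap.pi fun i => if hi : (i : ℕ) < k + s then
        (ContinuousLinearMap.proj ⟨i + 1, by omega⟩ : JetModel E (k + s) →L[ℝ] E) else 0
    have hW : ∀ (q : JetModel E (k + s)) (i : Fin (k + s + 1)) (hi : (i : ℕ) < k + s),
        W q i = q ⟨i + 1, by omega⟩ := fun q i hi => by simp [W, hi]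
    have hq' : truncL E (k + s).le_succ q ∈ cyl (k + s) S := hq
    set q₁ := truncL E (k + s).le_succ q
    set u := shiftL E (m := k + s) le_rfl q
    have hA := contDiffAt_locDTFormIter ha s _ hq'
    have hAd := hA.differentiableAt (by simp)
    have hev : locDTFunIter f s =ᶠ[𝓝 q₁] fun q' => locDTFormIter a s q' (W q') := by
      filter_upwards [(isOpen_cyl _ hS).mem_nhds hq'] with q' hq''
      exact (ih q' hq'' _ fun i hi _ => hW q' i hi).symm
    have hzero := locDTFormIter_semibasic hS ha h0 s
    change locDTForm (locDTFormIter a s) q w = fderiv ℝ (locDTFunIter f s) q₁ u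
    rw [hev.fderiv_eq, fderiv_clm_apply hAd (by fun_prop), locDTForm_apply]
    simp only [ContinuousLinearMap.fderiv, add_apply,
      ContinuousLinearMap.comp_apply, ContinuousLinearMap.flip_apply]
    have h1 : fderiv ℝ (locDTFormIter a s) q₁ u (truncL E (k + s).le_succ w - W q₁) = 0 := by
      refine fderiv_apply_const_eq_zero hA ?_ u
      filter_upwards [(isOpen_cyl _ hS).mem_nhds hq'] with q' hq''
      refine hzero q' hq'' _ fun i hi => ?_
      rw [Pi.sub_apply, hW _ _ (by omega), sub_eq_zero]
      exact hw ⟨i, by omega⟩ (by simp; omega) (by simp; omega)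
    have h2 : locDTFormIter a s q₁ (shiftL E le_rfl w - W u) = 0 := by
      refine hzero q₁ hq' _ fun i hi => ?_
      rw [Pi.sub_apply, hW _ _ (by omega), sub_eq_zero]
      exact hw ⟨i + 1, by omega⟩ (by simp; omega) (by simp; omega)
    rw [map_sub, sub_eq_zero] at h1 h2
    rw [h1, h2, add_comm]

/-- The value of `d_T^s a` at the vectors whose components of index `< c + s` vanish. -/
lemma locDTFormIter_top {k c : ℕ} {a : JetModel E k → JetModel E k →L[ℝ] ℝ} (hS : IsOpen S)
    (ha : ∀ q ∈ cyl k S, ContDiffAt ℝ ∞ a q)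
    (h0 : ∀ q ∈ cyl k S, ∀ v : JetModel E k, (∀ i : Fin (k + 1), (i : ℕ) < c + 1 → v i = 0) →
      a q v = 0)
    (hc : c ≤ k) (s : ℕ) :
    ∀ q ∈ cyl (k + s) S, ∀ v : JetModel E (k + s),
      (∀ i : Fin (k + s + 1), (i : ℕ) < c + s → v i = 0) →
      locDTFormIter a s q v =
        a (truncL E (k.le_add_right s) q) (Pi.single ⟨c, by omega⟩ (v ⟨c + s, by omega⟩)) := by
  induction s with
  | zero =>
    intro q hq v hv
    -- After subtraction of its component in slot `c`, the vector vanishes in all slots seen by the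
    -- semibasic form.
    have h := h0 q hq (v - Pi.single ⟨c, by omega⟩ (v ⟨c, by omega⟩)) fun i hi => ?_
    · rw [map_sub, sub_eq_zero] at h
      exact h
    · rcases Nat.lt_succ_iff_lt_or_eq.1 hi with hi' | hi'
      · have : i ≠ ⟨c, by omega⟩ := fun hh => by simp [hh] at hi'
        simp [this, hv i hi']
      · have : i = ⟨c, by omega⟩ := Fin.ext hi'
        simp [this]
  | succ s ih =>
    intro q hq v hv
    have hq' : truncL E (k + s).le_succ q ∈ cyl (k + s) S := hq
    change locDTForm (locDTFormIter a s) q v = _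
    -- The derivative term dies by semibasicity, so each application of `d_T` only moves the
    -- surviving component down by one slot.
    rw [locDTForm_apply, fderiv_apply_const_eq_zero (contDiffAt_locDTFormIter ha s _ hq') ?_,
      ih _ hq' _ ?_, zero_add]
    · rfl
    · intro i hi
      exact hv _ (by simp; omega)
    · filter_upwards [(isOpen_cyl _ hS).mem_nhds hq'] with q' hq''
      exact locDTFormIter_semibasic hS ha h0 s q' hq'' _ fun i hi => hv _ (by simp; omega)

end LocalTulczyjew

/-! ### Independence of the chart for `d_T` on forms. -/

section Naturality

variable {E : Type*} [NormedAddCommGroup E] [NormedSpace ℝ E]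
  {Q : Type*} [TopologicalSpace Q] [ChartedSpace E Q] [IsManifold 𝓘(ℝ, E) ∞ Q]
  {e e' : atlas E Q}

lemma differentiableAt_jetTrans {k : ℕ} {q : JetModel E k} (hq : q ∈ transDomain k e e') :
    DifferentiableAt ℝ (jetTrans k e e') q :=
  (contDiffAt_jetTrans hq).differentiableAt (by simp)

/-- The coordinate formula for `d_T` commutes with pullback by a chart change. It transfers the
formula from the preferred chart of each point to one fixed chart on an open set, where it can be
iterated. -/
lemma locDTForm_jetTrans {k : ℕ} {a a' : JetModel E k → JetModel E k →L[ℝ] ℝ}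
    {q : JetModel E (k + 1)} (hq : q ∈ transDomain (k + 1) e e')
    (ha' : DifferentiableAt ℝ a' (jetTrans k e e' (truncL E k.le_succ q)))
    (haa' : ∀ q ∈ transDomain k e e',
      a q = (a' (jetTrans k e e' q)).comp (fderiv ℝ (jetTrans k e e') q)) :
    locDTForm a q = (locDTForm a' (jetTrans (k + 1) e e' q)).comp
      (fderiv ℝ (jetTrans (k + 1) e e') q) := by
  have hq' : truncL E k.le_succ q ∈ transDomain k e e' := hq
  have hev : a =ᶠ[𝓝 (truncL E k.le_succ q)]
      fun q => (a' (jetTrans k e e' q)).comp (fderiv ℝ (jetTrans k e e') q) := by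
    filter_upwards [(isOpen_transDomain k).mem_nhds hq'] with q' h
    exact haa' q' h
  have hT := contDiffAt_jetTrans hq'
  have hTd := differentiableAt_jetTrans hq'
  have hT2 : DifferentiableAt ℝ (fderiv ℝ (jetTrans k e e')) (truncL E k.le_succ q) :=
    (contDiffAt_fderiv_infty hT).differentiableAt (by simp)
  have hsymm := (eventually_contDiffAt_nat hT 2).self_of_nhds.isSymmSndFDerivAt (by simp)
  -- the derivative of `shift ∘ T = DT (shift)`
  have hshift : ∀ v, shiftL E le_rfl (fderiv ℝ (jetTrans (k + 1) e e') q v) =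
      fderiv ℝ (fderiv ℝ (jetTrans k e e')) (truncL E k.le_succ q) (truncL E k.le_succ v)
        (shiftL E le_rfl q) +
      fderiv ℝ (jetTrans k e e') (truncL E k.le_succ q) (shiftL E le_rfl v) := by
    intro v
    have hev2 : (fun q => shiftL E (m := k) le_rfl (jetTrans (k + 1) e e' q)) =ᶠ[𝓝 q]
        fun q => fderiv ℝ (jetTrans k e e') (truncL E k.le_succ q) (shiftL E le_rfl q) := by
      filter_upwards [(isOpen_transDomain (k + 1)).mem_nhds hq] with q' h
      exact (fderiv_jetTrans_shift le_rfl h).symm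
    have h1 : HasFDerivAt (fun q => shiftL E (m := k) le_rfl (jetTrans (k + 1) e e' q))
        ((shiftL E (m := k) le_rfl).comp (fderiv ℝ (jetTrans (k + 1) e e') q)) q :=
      (shiftL E (m := k) le_rfl).hasFDerivAt.comp q (differentiableAt_jetTrans hq).hasFDerivAt
    have h2 : HasFDerivAt (fun q => fderiv ℝ (jetTrans k e e') (truncL E k.le_succ q))
        ((fderiv ℝ (fderiv ℝ (jetTrans k e e')) (truncL E k.le_succ q)).comp
          (truncL E k.le_succ)) q :=
      hT2.hasFDerivAt.comp q (truncL E k.le_succ).hasFDerivAt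
    have h3 := h2.clm_apply (shiftL E (m := k) le_rfl).hasFDerivAt
    have h4 := congrArg (fun A => A v) (h1.unique (h3.congr_of_eventuallyEq hev2))
    simpa [add_comm] using h4
  ext v
  have hcomp : HasFDerivAt (fun q => a' (jetTrans k e e' q))
      ((fderiv ℝ a' (jetTrans k e e' (truncL E k.le_succ q))).comp
        (fderiv ℝ (jetTrans k e e') (truncL E k.le_succ q))) (truncL E k.le_succ q) :=
    ha'.hasFDerivAt.comp _ hTd.hasFDerivAt
  have hfd := (hcomp.clm_comp hT2.hasFDerivAt).congr_of_eventuallyEq hev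
  -- The product rule yields `D²T (shift q) (trunc v)`, whereas `hshift` yields the same expression
  -- with its arguments exchanged; `hsymm` identifies them.
  rw [locDTForm_apply, hfd.fderiv, haa' _ hq', ContinuousLinearMap.comp_apply,
    ContinuousLinearMap.comp_apply, locDTForm_apply, hshift, truncL_jetTrans _ hq,
    ← fderiv_jetTrans_trunc _ hq, ← fderiv_jetTrans_shift le_rfl hq,
    hsymm.eq (truncL E k.le_succ v) (shiftL E le_rfl q), map_add, ← add_assoc]
  congr 1
  exact add_comm _ _

end Naturality

/-! ### Coordinate expressions of the intrinsic objects on `T^k Q`. -/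

section JetCoordinates

variable {E : Type*} [NormedAddCommGroup E] [NormedSpace ℝ E]
  {Q : Type*} [TopologicalSpace Q] [ChartedSpace E Q] [IsManifold 𝓘(ℝ, E) ∞ Q]

variable (E) in
/-- The preferred chart of `Q` at a point, as an element of the atlas. -/
def baseChart (x : Q) : atlas E Q := ⟨chartAt E x, chart_mem_atlas E x⟩

/-- The chart of `T^k Q` induced by a chart of `Q`. -/
def jetHomeo (k : ℕ) (e : atlas E Q) : OpenPartialHomeomorph (Jet E Q k) (JetModel E k) :=
  (jetCore E Q k).openPartialHomeomorph (jetChart k e) (Set.mem_range_self e)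

/-- The jet with given coordinates. -/
def jetPt (k : ℕ) (e : atlas E Q) (q : JetModel E k) : Jet E Q k := (jetChart k e).symm q

lemma coe_jetHomeo (k : ℕ) (e : atlas E Q) : ⇑(jetHomeo k e) = jetChart k e := rfl

lemma coe_jetHomeo_symm (k : ℕ) (e : atlas E Q) : ⇑(jetHomeo k e).symm = jetPt k e := rfl

lemma chartAt_jet (k : ℕ) (p : Jet E Q k) :
    chartAt (JetModel E k) p = jetHomeo k (baseChart E p.base) := rfl

lemma jetHomeo_mem_atlas (k : ℕ) (e : atlas E Q) :
    jetHomeo k e ∈ atlas (JetModel E k) (Jet E Q k) := by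
  simp only [atlas, ChartedSpace.atlas, Set.mem_iUnion]
  exact ⟨_, Set.mem_range_self e, rfl⟩

lemma coe_extChartAt_jet (k : ℕ) (p : Jet E Q k) :
    ⇑(extChartAt (jetI E k) p) = jetChart k (baseChart E p.base) := by
  simp [chartAt_jet, coe_jetHomeo]

lemma coe_extChartAt_jet_symm (k : ℕ) (p : Jet E Q k) :
    ⇑(extChartAt (jetI E k) p).symm = jetPt k (baseChart E p.base) := by
  simp [chartAt_jet, coe_jetHomeo_symm]

variable {e e' e'' : atlas E Q}

lemma contMDiffAt_jetPt {k : ℕ} {q : JetModel E k} (hq : q ∈ cyl k e.1.target) :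
    ContMDiffAt 𝓘(ℝ, JetModel E k) (jetI E k) ∞ (jetPt k e) q :=
  contMDiffAt_symm_of_mem_maximalAtlas (I := jetI E k) (n := ∞)
    (IsManifold.subset_maximalAtlas (jetHomeo_mem_atlas k e)) hq

lemma base_jetPt {k : ℕ} {q : JetModel E k} (hq : q ∈ cyl k e.1.target) :
    (jetPt k e q).base = e.1.symm (q 0) := by
  change (chartCurve e q).toFun 0 = _
  exact chartCurve_zero e hq

lemma jetChart_jetPt {k : ℕ} {q : JetModel E k} (hq : q ∈ cyl k e.1.target) :
    jetChart k e (jetPt k e q) = q :=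
  (jetChart k e).right_inv hq

lemma jetPt_jetChart {k : ℕ} {p : Jet E Q k} (hp : p.base ∈ e.1.source) :
    jetPt k e (jetChart k e p) = p :=
  (jetChart k e).left_inv hp

lemma jetChart_mem {k : ℕ} {p : Jet E Q k} (hp : p.base ∈ e.1.source) :
    jetChart k e p ∈ cyl k e.1.target :=
  (jetChart k e).map_source hp

omit [NormedSpace ℝ E] [IsManifold 𝓘(ℝ, E) ∞ Q] in
lemma base_mem_baseChart (x : Q) : x ∈ (baseChart E x).1.source := mem_chart_source E x

lemma mem_transDomain_base {k : ℕ} {q : JetModel E k} (hq : q ∈ cyl k e.1.target) :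
    q ∈ transDomain k e (baseChart E (jetPt k e q).base) := by
  refine ⟨hq, ?_⟩
  rw [base_jetPt hq]
  exact base_mem_baseChart _

lemma jetPt_jetTrans {k : ℕ} {q : JetModel E k} (hq : q ∈ transDomain k e e') :
    jetPt k e' (jetTrans k e e' q) = jetPt k e q := by
  refine jetPt_jetChart ?_
  change (jetPt k e q).base ∈ _
  rw [base_jetPt hq.1]
  exact hq.2

lemma proj_jetPt {m N : ℕ} (h : m ≤ N) {q : JetModel E N} (hq : q ∈ cyl N e.1.target) :
    (jetPt N e q).proj h = jetPt m e (truncL E h q) := by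
  have hb : (jetPt N e q).base ∈ e.1.source := by
    rw [base_jetPt hq]; exact e.1.map_target hq
  have hb' : ((jetPt N e q).proj h).base ∈ e.1.source := by rwa [base_proj]
  rw [← jetPt_jetChart hb']
  congr 1
  funext i
  refine (coord_proj h e.2 hb i).trans ?_
  exact congrFun (jetChart_jetPt hq) _

lemma jetTrans_comp {k : ℕ} {q : JetModel E k} (h : q ∈ transDomain k e e') :
    jetTrans k e' e'' (jetTrans k e e' q) = jetTrans k e e'' q :=
  congrArg (jetChart k e'') (jetPt_jetTrans h)

lemma fderiv_jetTrans_comp {k : ℕ} {q : JetModel E k} (h : q ∈ transDomain k e e')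
    (h' : q ∈ transDomain k e e'') :
    fderiv ℝ (jetTrans k e e'') q =
      (fderiv ℝ (jetTrans k e' e'') (jetTrans k e e' q)).comp (fderiv ℝ (jetTrans k e e') q) := by
  have hev : jetTrans k e e'' =ᶠ[𝓝 q] jetTrans k e' e'' ∘ jetTrans k e e' := by
    filter_upwards [(isOpen_transDomain k).mem_nhds h] with q' hq'
    exact (jetTrans_comp hq').symm
  have hmem : jetTrans k e e' q ∈ transDomain k e' e'' := by
    refine ⟨(jetTrans_mem h).1, ?_⟩
    rw [jetTrans_zero h, e'.1.left_inv h.2]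
    exact h'.2
  rw [hev.fderiv_eq, fderiv_comp _ (differentiableAt_jetTrans hmem) (differentiableAt_jetTrans h)]

lemma jetTrans_self {k : ℕ} {q : JetModel E k} (hq : q ∈ cyl k e.1.target) :
    jetTrans k e e q = q :=
  jetChart_jetPt hq

lemma fderiv_jetTrans_self {k : ℕ} {q : JetModel E k} (hq : q ∈ cyl k e.1.target) :
    fderiv ℝ (jetTrans k e e) q = ContinuousLinearMap.id ℝ _ := by
  have hev : jetTrans k e e =ᶠ[𝓝 q] id := by
    filter_upwards [(isOpen_cyl k e.1.open_target).mem_nhds hq] with q' hq'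
    exact jetTrans_self hq'
  rw [hev.fderiv_eq, fderiv_id]

/-- The tangent space at a jet is read in the preferred chart of that jet. The derivative of an
inverse chart is therefore that of a transition to a chart varying with the point, and is not the
identity in general. -/
lemma mfderiv_jetPt {k : ℕ} {q : JetModel E k} (hq : q ∈ cyl k e.1.target) :
    (mfderiv 𝓘(ℝ, JetModel E k) (jetI E k) (jetPt k e) q : JetModel E k →L[ℝ] JetModel E k) =
      fderiv ℝ (jetTrans k e (baseChart E (jetPt k e q).base)) q := by
  refine ((contMDiffAt_jetPt hq).mdifferentiableAt (by simp)).mfderiv.trans ?_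
  simp only [writtenInExtChartAt, coe_extChartAt_jet]
  simp only [mfld_simps]
  rw [fderivWithin_univ]
  rfl

/-- The value of a `1`-form at a point, as a linear form on the model space. -/
def covec {k : ℕ} (α : JetForm E Q k) (p : Jet E Q k) : JetModel E k →L[ℝ] ℝ := α p

/-- The coordinate expression of a `1`-form on `T^k Q`. -/
def locForm {k : ℕ} (e : atlas E Q) (α : JetForm E Q k) (q : JetModel E k) :
    JetModel E k →L[ℝ] ℝ :=
  (covec α (jetPt k e q)).comp
    (fderiv ℝ (jetTrans k e (baseChart E (jetPt k e q).base)) q)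

lemma locForm_jetTrans {k : ℕ} (α : JetForm E Q k) {q : JetModel E k}
    (hq : q ∈ transDomain k e e') :
    locForm e α q = (locForm e' α (jetTrans k e e' q)).comp (fderiv ℝ (jetTrans k e e') q) := by
  rw [locForm, locForm, jetPt_jetTrans hq, fderiv_jetTrans_comp hq (mem_transDomain_base hq.1),
    ContinuousLinearMap.comp_assoc]

lemma locForm_baseChart {k : ℕ} (α : JetForm E Q k) (p : Jet E Q k) :
    locForm (baseChart E p.base) α (jetChart k (baseChart E p.base) p) = covec α p := by
  have hp := base_mem_baseChart (E := E) p.base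
  rw [locForm, jetPt_jetChart hp, fderiv_jetTrans_self (jetChart_mem hp)]
  rfl

/-- A `1`-form on `T^k Q` with smooth coordinate expressions. -/
def SmoothForm {k : ℕ} (α : JetForm E Q k) : Prop :=
  ∀ (e : atlas E Q), ∀ q ∈ cyl k e.1.target, ContDiffAt ℝ ∞ (locForm e α) q

lemma contDiffAt_comp_jetPt {k : ℕ} {f : Jet E Q k → ℝ} (hf : ContMDiff (jetI E k) 𝓘(ℝ, ℝ) ∞ f)
    {q : JetModel E k} (hq : q ∈ cyl k e.1.target) : ContDiffAt ℝ ∞ (f ∘ jetPt k e) q :=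
  (hf.contMDiffAt.comp q (contMDiffAt_jetPt hq)).contDiffAt

lemma contMDiffAt_of_comp_jetPt {k : ℕ} {f : Jet E Q k → ℝ} {p : Jet E Q k}
    (hp : p.base ∈ e.1.source)
    (hf : ContDiffAt ℝ ∞ (f ∘ jetPt k e) (jetChart k e p)) :
    ContMDiffAt (jetI E k) 𝓘(ℝ, ℝ) ∞ f p := by
  have h1 : ContMDiffAt (jetI E k) 𝓘(ℝ, JetModel E k) ∞ (jetHomeo k e) p :=
    contMDiffAt_of_mem_maximalAtlas
      (IsManifold.subset_maximalAtlas (jetHomeo_mem_atlas k e)) hp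
  refine (ContMDiffAt.comp p (g := f ∘ jetPt k e) hf.contMDiffAt h1).congr_of_eventuallyEq ?_
  filter_upwards [(jetHomeo k e).open_source.mem_nhds hp] with p' hp'
  exact congrArg f (jetPt_jetChart hp').symm

/-- The differential of a function, as a `1`-form. -/
def dForm {k : ℕ} (f : Jet E Q k → ℝ) : JetForm E Q k := fun p => mfderiv (jetI E k) 𝓘(ℝ, ℝ) f p

lemma locForm_dForm {k : ℕ} {f : Jet E Q k → ℝ} {q : JetModel E k} (hq : q ∈ cyl k e.1.target)
    (hf : MDifferentiableAt (jetI E k) 𝓘(ℝ, ℝ) f (jetPt k e q)) :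
    locForm e (dForm f) q = fderiv ℝ (f ∘ jetPt k e) q := by
  rw [← mfderiv_eq_fderiv, mfderiv_comp (I' := jetI E k) q hf
    ((contMDiffAt_jetPt hq).mdifferentiableAt (by simp))]
  exact congrArg (ContinuousLinearMap.comp _) (mfderiv_jetPt hq).symm

lemma mfderiv_eq_fderiv_jetPt {k : ℕ} {f : Jet E Q k → ℝ} {p : Jet E Q k}
    (hf : MDifferentiableAt (jetI E k) 𝓘(ℝ, ℝ) f p) :
    covec (dForm f) p =
      fderiv ℝ (f ∘ jetPt k (baseChart E p.base)) (jetChart k (baseChart E p.base) p) := by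
  have hp := base_mem_baseChart (E := E) p.base
  rw [← locForm_dForm (jetChart_mem hp) (by rwa [jetPt_jetChart hp]), locForm_baseChart]

lemma jetChart_proj {m N : ℕ} (h : m ≤ N) {p : Jet E Q N} (hp : p.base ∈ e.1.source) :
    jetChart m e (p.proj h) = truncL E h (jetChart N e p) :=
  funext fun i => coord_proj h e.2 hp i

/-- The preferred charts at `p` and at its projection are induced by the same chart of `Q`, because
the base points agree. -/
lemma mfderiv_proj {m N : ℕ} (h : m ≤ N) (p : Jet E Q N) :
    (mfderiv (jetI E N) (jetI E m) (Jet.proj h) p : JetModel E N →L[ℝ] JetModel E m) =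
      truncL E h := by
  have hp := base_mem_baseChart (E := E) p.base
  refine ((contMDiff_proj h p).mdifferentiableAt (by simp)).mfderiv.trans ?_
  simp only [writtenInExtChartAt, coe_extChartAt_jet, coe_extChartAt_jet_symm, base_proj]
  simp only [mfld_simps]
  rw [fderivWithin_univ]
  have hev : (jetChart m (baseChart E p.base) ∘ Jet.proj h ∘ jetPt N (baseChart E p.base))
      =ᶠ[𝓝 (jetChart N (baseChart E p.base) p)] truncL E h := by
    filter_upwards [(isOpen_cyl N (baseChart E p.base).1.open_target).mem_nhds (jetChart_mem hp)]
      with q hq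
    simp only [Function.comp_apply]
    rw [proj_jetPt h hq, jetChart_jetPt]
    exact hq
  rw [hev.fderiv_eq, ContinuousLinearMap.fderiv]

/-- The coordinate expression of the contraction of a `1`-form with `j_{m+1}`. -/
lemma contraction_jetPt {m N : ℕ} (h : m + 1 ≤ N) (α : JetForm E Q m) {q : JetModel E N}
    (hq : q ∈ cyl N e.1.target) :
    covec α ((jetPt N e q).proj (m.le_succ.trans h)) (canonicalInj h (jetPt N e q)) =
      locForm e α (truncL E (m.le_succ.trans h) q) (shiftL E h q) := by
  have hq' : truncL E (m.le_succ.trans h) q ∈ cyl m e.1.target := hq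
  have hb : (jetPt m e (truncL E (m.le_succ.trans h) q)).base = (jetPt N e q).base := by
    rw [base_jetPt hq', base_jetPt hq]; rfl
  rw [locForm, ContinuousLinearMap.comp_apply, hb,
    fderiv_jetTrans_shift h (mem_transDomain_base hq), proj_jetPt _ hq]
  rfl

lemma dTFun_jetPt {k : ℕ} {f : Jet E Q k → ℝ} (hf : ContMDiff (jetI E k) 𝓘(ℝ, ℝ) ∞ f)
    {q : JetModel E (k + 1)} (hq : q ∈ cyl (k + 1) e.1.target) :
    dTFun f (jetPt (k + 1) e q) = locDTFun (f ∘ jetPt k e) q := by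
  rw [locDTFun, ← locForm_dForm (e := e) (f := f) (q := truncL E k.le_succ q) hq
    (hf.mdifferentiableAt (by simp))]
  exact contraction_jetPt le_rfl (dForm f) hq

lemma contMDiff_dTFun {k : ℕ} {f : Jet E Q k → ℝ} (hf : ContMDiff (jetI E k) 𝓘(ℝ, ℝ) ∞ f) :
    ContMDiff (jetI E (k + 1)) 𝓘(ℝ, ℝ) ∞ (dTFun f) := by
  intro p
  have hp := base_mem_baseChart (E := E) p.base
  refine contMDiffAt_of_comp_jetPt hp ?_
  have hq := jetChart_mem (k := k + 1) hp
  refine (contDiffAt_locDTFun (contDiffAt_comp_jetPt hf hq)).congr_of_eventuallyEq ?_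
  filter_upwards [(isOpen_cyl _ (baseChart E p.base).1.open_target).mem_nhds hq] with q' hq'
  exact dTFun_jetPt hf hq'

/-- Smoothness is part of the induction, because the next `d_T` differentiates; the equality is
wanted on an open cylinder so that it may be differentiated too. -/
lemma dTFunIter_jetPt {k : ℕ} {f : Jet E Q k → ℝ} (hf : ContMDiff (jetI E k) 𝓘(ℝ, ℝ) ∞ f)
    (s : ℕ) : ContMDiff (jetI E (k + s)) 𝓘(ℝ, ℝ) ∞ (dTFunIter f s) ∧
      ∀ q ∈ cyl (k + s) e.1.target,
        dTFunIter f s (jetPt (k + s) e q) = locDTFunIter (f ∘ jetPt k e) s q := by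
  induction s with
  | zero => exact ⟨hf, fun _ _ => rfl⟩
  | succ s ih =>
    refine ⟨contMDiff_dTFun ih.1, fun q hq => ?_⟩
    refine (dTFun_jetPt ih.1 hq).trans ?_
    have hq' : truncL E (k + s).le_succ q ∈ cyl (k + s) e.1.target := hq
    have hev : dTFunIter f s ∘ jetPt (k + s) e =ᶠ[𝓝 (truncL E (k + s).le_succ q)]
        locDTFunIter (f ∘ jetPt k e) s := by
      filter_upwards [(isOpen_cyl _ e.1.open_target).mem_nhds hq'] with q' h
      exact ih.2 q' h
    change locDTFun _ q = locDTFun _ q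
    rw [locDTFun, locDTFun, hev.fderiv_eq]

lemma dTForm_eq {k : ℕ} {α : JetForm E Q k} (hα : SmoothForm α) (p : Jet E Q (k + 1)) :
    covec (dTForm α) p =
      locDTForm (locForm (baseChart E p.base) α) (jetChart (k + 1) (baseChart E p.base) p) := by
  have hp := base_mem_baseChart (E := E) p.base
  set e := baseChart E p.base with he
  set q := jetChart (k + 1) e p with hqdef
  have hq : q ∈ cyl (k + 1) e.1.target := jetChart_mem hp
  have hq' : truncL E k.le_succ q ∈ cyl k e.1.target := hq
  have hαq := hα e _ hq'
  have hαd := hαq.differentiableAt (by simp)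
  -- the contraction
  have hev : (fun p' : Jet E Q (k + 1) => α (p'.proj k.le_succ) (canonicalInj le_rfl p')) ∘
      jetPt (k + 1) e =ᶠ[𝓝 q]
      fun q => locForm e α (truncL E k.le_succ q) (shiftL E le_rfl q) := by
    filter_upwards [(isOpen_cyl _ e.1.open_target).mem_nhds hq] with q' h
    exact contraction_jetPt le_rfl α h
  have hcomp : ContDiffAt ℝ ∞ (fun q => locForm e α (truncL E k.le_succ q)) q :=
    hαq.comp q (truncL E k.le_succ).contDiff.contDiffAt
  have hsm := hcomp.clm_apply (shiftL E (m := k) le_rfl).contDiff.contDiffAt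
  have hdi := mfderiv_eq_fderiv_jetPt
    ((contMDiffAt_of_comp_jetPt hp (hsm.congr_of_eventuallyEq hev)).mdifferentiableAt (by simp))
  have hd1 : HasFDerivAt (fun q => locForm e α (truncL E k.le_succ q))
      ((fderiv ℝ (locForm e α) (truncL E k.le_succ q)).comp (truncL E k.le_succ)) q :=
    hαd.hasFDerivAt.comp q (truncL E k.le_succ).hasFDerivAt
  rw [← he, hev.fderiv_eq,
    (hd1.clm_apply (shiftL E (m := k) le_rfl).hasFDerivAt).fderiv] at hdi
  -- the exterior derivative
  have hext : (extDerivOne (jetI E k) α (p.proj k.le_succ) :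
      JetModel E k →L[ℝ] JetModel E k →L[ℝ] ℝ) =
      fderiv ℝ (locForm e α) (truncL E k.le_succ q) -
        (fderiv ℝ (locForm e α) (truncL E k.le_succ q)).flip := by
    have hev2 : (fun y => (α ((extChartAt (jetI E k) (p.proj k.le_succ)).symm y)).comp
        (mfderiv 𝓘(ℝ, JetModel E k) (jetI E k)
          (extChartAt (jetI E k) (p.proj k.le_succ)).symm y) :
        JetModel E k → JetModel E k →L[ℝ] ℝ) =ᶠ[𝓝 (truncL E k.le_succ q)] locForm e α := by
      rw [coe_extChartAt_jet_symm, base_proj]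
      filter_upwards [(isOpen_cyl _ e.1.open_target).mem_nhds hq'] with q' h
      exact congrArg (ContinuousLinearMap.comp _) (mfderiv_jetPt h)
    have hpt : extChartAt (jetI E k) (p.proj k.le_succ) (p.proj k.le_succ) =
        truncL E k.le_succ q := by
      rw [coe_extChartAt_jet, base_proj]
      exact jetChart_proj _ hp
    have := hev2.fderiv_eq (𝕜 := ℝ)
    rw [← hpt] at this ⊢
    exact congrArg (fun D : JetModel E k →L[ℝ] JetModel E k →L[ℝ] ℝ => D - D.flip) this
  -- Generalizing the three ingredients lets the definition unfold over the model spaces, so that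
  -- their coordinate expressions can be substituted.
  have key : ∀ (D : JetModel E k →L[ℝ] JetModel E k →L[ℝ] ℝ)
      (P : JetModel E (k + 1) →L[ℝ] JetModel E k) (B : JetModel E (k + 1) →L[ℝ] ℝ),
      extDerivOne (jetI E k) α (p.proj k.le_succ) = D →
      mfderiv (jetI E (k + 1)) (jetI E k) (Jet.proj k.le_succ) p = P →
      covec (dForm fun p' : Jet E Q (k + 1) => α (p'.proj k.le_succ) (canonicalInj le_rfl p')) p =
        B → covec (dTForm α) p = (D (shiftL E le_rfl q)).comp P + B := by
    rintro _ _ _ rfl rfl rfl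
    rfl
  rw [key _ _ _ hext (mfderiv_proj k.le_succ p) hdi]
  -- The antisymmetric term `-D (trunc v) (shift q)` of the exterior derivative cancels against the
  -- derivative of the contraction.
  ext v
  rw [locDTForm_apply]
  simp only [sub_apply, add_apply, ContinuousLinearMap.flip_apply,
    ContinuousLinearMap.comp_apply]
  ring

/-- `dTForm_eq` treats only the preferred chart at the point; naturality under `jetTrans` gives
every other chart. -/
lemma locForm_dTForm {k : ℕ} {α : JetForm E Q k} (hα : SmoothForm α) {q : JetModel E (k + 1)}
    (hq : q ∈ cyl (k + 1) e.1.target) :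
    locForm e (dTForm α) q = locDTForm (locForm e α) q := by
  have ht := mem_transDomain_base hq
  have ht' : truncL E k.le_succ q ∈ transDomain k e (baseChart E (jetPt (k + 1) e q).base) := ht
  rw [locForm, dTForm_eq hα, locDTForm_jetTrans ht
    ((hα _ _ (jetTrans_mem ht').1).differentiableAt (by simp))
    (fun q' hq' => locForm_jetTrans α hq')]
  rfl

lemma smoothForm_dTForm {k : ℕ} {α : JetForm E Q k} (hα : SmoothForm α) :
    SmoothForm (dTForm α) := by
  intro e q hq
  refine (contDiffAt_locDTForm (hα e _ hq)).congr_of_eventuallyEq ?_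
  filter_upwards [(isOpen_cyl _ e.1.open_target).mem_nhds hq] with q' h
  exact locForm_dTForm hα h

lemma locForm_dTFormIter {k : ℕ} {α : JetForm E Q k} (hα : SmoothForm α) (s : ℕ) :
    SmoothForm (dTFormIter α s) ∧ ∀ q ∈ cyl (k + s) e.1.target,
      locForm e (dTFormIter α s) q = locDTFormIter (locForm e α) s q := by
  induction s with
  | zero => exact ⟨hα, fun _ _ => rfl⟩
  | succ s ih =>
    refine ⟨smoothForm_dTForm ih.1, fun q hq => ?_⟩
    refine (locForm_dTForm ih.1 hq).trans ?_
    have hq' : truncL E (k + s).le_succ q ∈ cyl (k + s) e.1.target := hq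
    have hev : locForm e (dTFormIter α s) =ᶠ[𝓝 (truncL E (k + s).le_succ q)]
        locDTFormIter (locForm e α) s := by
      filter_upwards [(isOpen_cyl _ e.1.open_target).mem_nhds hq'] with q' h
      exact ih.2 q' h
    change locDTForm _ q = locDTForm _ q
    rw [locDTForm, locDTForm, hev.fderiv_eq, hev.self_of_nhds]

/-- `vertEnd` is given in the preferred chart of each point; it has the same form in `e` because
`vertL` commutes with transitions. -/
lemma locForm_vertDiff {k : ℕ} (r : ℕ) {f : Jet E Q k → ℝ}
    (hf : ContMDiff (jetI E k) 𝓘(ℝ, ℝ) ∞ f) {q : JetModel E k} (hq : q ∈ cyl k e.1.target) :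
    locForm e (vertDiff r f) q = (fderiv ℝ (f ∘ jetPt k e) q).comp (vertL E k r) := by
  rw [← locForm_dForm hq (hf.mdifferentiableAt (by simp))]
  ext v
  exact congrArg (covec (dForm f) (jetPt k e q))
    (fderiv_jetTrans_vertL r (mem_transDomain_base hq) v).symm

lemma smoothForm_vertDiff {k : ℕ} (r : ℕ) {f : Jet E Q k → ℝ}
    (hf : ContMDiff (jetI E k) 𝓘(ℝ, ℝ) ∞ f) : SmoothForm (vertDiff r f) := by
  intro e q hq
  have h := (contDiffAt_fderiv_infty (contDiffAt_comp_jetPt hf hq)).clm_comp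
    (contDiffAt_const (c := vertL E k r))
  refine h.congr_of_eventuallyEq ?_
  filter_upwards [(isOpen_cyl _ e.1.open_target).mem_nhds hq] with q' hq'
  exact locForm_vertDiff r hf hq'

lemma canonicalField_jetPt {k : ℕ} (s : ℕ) {f : Jet E Q k → ℝ}
    (hf : ContMDiff (jetI E k) 𝓘(ℝ, ℝ) ∞ f) {q : JetModel E k} (hq : q ∈ cyl k e.1.target) :
    mfderiv (jetI E k) 𝓘(ℝ, ℝ) f (jetPt k e q) (canonicalField s (jetPt k e q)) =
      fderiv ℝ (f ∘ jetPt k e) q (deltaL E k s q) := by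
  rw [← locForm_dForm hq (hf.mdifferentiableAt (by simp))]
  exact congrArg (covec (dForm f) (jetPt k e q))
    (fderiv_jetTrans_deltaL s (mem_transDomain_base hq)).symm

lemma contMDiff_canonicalField {k : ℕ} (s : ℕ) {f : Jet E Q k → ℝ}
    (hf : ContMDiff (jetI E k) 𝓘(ℝ, ℝ) ∞ f) :
    ContMDiff (jetI E k) 𝓘(ℝ, ℝ) ∞ fun p : Jet E Q k =>
      mfderiv (jetI E k) 𝓘(ℝ, ℝ) f p (canonicalField s p) := by
  intro p
  have hp := base_mem_baseChart (E := E) p.base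
  refine contMDiffAt_of_comp_jetPt hp ?_
  have hq := jetChart_mem (k := k) hp
  have h := (contDiffAt_fderiv_infty (contDiffAt_comp_jetPt hf hq)).clm_apply
    (deltaL E k s).contDiff.contDiffAt
  refine h.congr_of_eventuallyEq ?_
  filter_upwards [(isOpen_cyl _ (baseChart E p.base).1.open_target).mem_nhds hq] with q' hq'
  exact canonicalField_jetPt s hf hq'

lemma pullForm_eq {m N : ℕ} (h : m ≤ N) (α : JetForm E Q m) (p : Jet E Q N) :
    covec (pullForm h α) p =
      (locForm (baseChart E p.base) α
        (truncL E h (jetChart N (baseChart E p.base) p))).comp (truncL E h) := by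
  have h1 := locForm_baseChart (E := E) α (p.proj h)
  rw [base_proj, jetChart_proj h (base_mem_baseChart (E := E) p.base)] at h1
  rw [h1]
  exact congrArg (ContinuousLinearMap.comp _) (mfderiv_proj h p)

end JetCoordinates

/-! ### Extension of coordinate vectors by zeros. -/

section ZeroLift

variable {E : Type*} [NormedAddCommGroup E] [NormedSpace ℝ E]

variable (E) in
/-- The coordinate expression `(v_0, …, v_m) ↦ (v_0, …, v_m, 0, …, 0)` of `zeroLift`. -/
def zeroL {m N : ℕ} (_h : m ≤ N) : JetModel E m →L[ℝ] JetModel E N :=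
  ContinuousLinearMap.pi fun i : Fin (N + 1) =>
    if hi : (i : ℕ) < m + 1 then
      (ContinuousLinearMap.proj ⟨i, hi⟩ : JetModel E m →L[ℝ] E) else 0

lemma zeroL_apply {m N : ℕ} (h : m ≤ N) (v : JetModel E m) (i : Fin (N + 1))
    (hi : (i : ℕ) < m + 1) : zeroL E h v i = v ⟨i, hi⟩ := by
  simp [zeroL, Nat.lt_succ_iff.1 hi]

end ZeroLift

/-! ### The Lagrangian form, the energy and the highest momentum. -/

section Momenta

variable {E : Type*} [NormedAddCommGroup E] [NormedSpace ℝ E]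
  {Q : Type*} [TopologicalSpace Q] [ChartedSpace E Q] [IsManifold 𝓘(ℝ, E) ∞ Q]
  {e : atlas E Q} {m : ℕ} {L : Jet E Q (m + 1) → ℝ}

lemma lagrangianForm_apply (hL : ContMDiff (jetI E (m + 1)) 𝓘(ℝ, ℝ) ∞ L)
    (p : Jet E Q (2 * m + 1)) (v : JetModel E (2 * m + 1)) :
    covec (lagrangianForm L) p v = ∑ s : Fin (m + 1),
      ((-1 : ℝ) ^ (s : ℕ) / ((s : ℕ) + 1).factorial) *
        locDTFormIter (locForm (baseChart E p.base) (vertDiff ((s : ℕ) + 1) L)) s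
          (truncL E (by omega) (jetChart (2 * m + 1) (baseChart E p.base) p))
          (truncL E (by omega) v) := by
  have h1 : covec (lagrangianForm L) p = ∑ s : Fin (m + 1),
      ((-1 : ℝ) ^ (s : ℕ) / ((s : ℕ) + 1).factorial) •
        covec (pullForm (m := m + 1 + s) (N := 2 * m + 1) (by omega)
          (dTFormIter (vertDiff ((s : ℕ) + 1) L) s)) p := rfl
  rw [h1, sum_apply]
  refine Finset.sum_congr rfl fun s _ => ?_
  have hp := base_mem_baseChart (E := E) p.base
  have hms : m + 1 + (s : ℕ) ≤ 2 * m + 1 := by omega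
  have hq : truncL E hms (jetChart (2 * m + 1) (baseChart E p.base) p) ∈
      cyl (m + 1 + s) (baseChart E p.base).1.target := jetChart_mem (k := 2 * m + 1) hp
  rw [pullForm_eq, (locForm_dTFormIter (smoothForm_vertDiff _ hL) s).2 _ hq]
  rfl

/-- Slot `i ≤ m + 1` of `J_{s+1} v` reads `v` at `i - (s + 1) ≤ m - s`, so higher slots of `v` play
no role. -/
lemma locForm_vertDiff_semibasic (hL : ContMDiff (jetI E (m + 1)) 𝓘(ℝ, ℝ) ∞ L) {s : ℕ}
    (hs : s ≤ m) (q : JetModel E (m + 1)) (hq : q ∈ cyl (m + 1) e.1.target)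
    (v : JetModel E (m + 1))
    (hv : ∀ i : Fin (m + 1 + 1), (i : ℕ) < m - s + 1 → v i = 0) :
    locForm e (vertDiff (s + 1) L) q v = 0 := by
  have h0 : vertL E (m + 1) (s + 1) v = 0 := by
    funext i
    rw [vertL_apply, hv _ (by simp; omega)]
    simp
  rw [locForm_vertDiff _ hL hq, ContinuousLinearMap.comp_apply, h0, map_zero]

/-- `E_L = i_T θ_L - L`. -/
lemma energy_eq (hL : ContMDiff (jetI E (m + 1)) 𝓘(ℝ, ℝ) ∞ L) (p : Jet E Q (2 * m + 1)) :
    energy L p = covec (lagrangianForm L) p (zeroL E (by omega : m ≤ 2 * m + 1)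
      (shiftL E (by omega) (jetChart (2 * m + 1) (baseChart E p.base) p))) -
      L (p.proj (by omega)) := by
  have hp := base_mem_baseChart (E := E) p.base
  rw [lagrangianForm_apply hL, energy]
  congr 1
  refine Finset.sum_congr rfl fun s _ => ?_
  congr 1
  set e := baseChart E p.base with he
  have hq := jetChart_mem (k := 2 * m + 1) hp
  set q := jetChart (2 * m + 1) e p with hqdef
  have hms : m + 1 + s ≤ 2 * m + 1 := by omega
  have hq' : truncL E hms q ∈ cyl (m + 1 + s) e.1.target := hq
  have hpq : p.proj hms = jetPt (m + 1 + s) e (truncL E hms q) := by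
    rw [← proj_jetPt hms hq, hqdef, jetPt_jetChart hp]
  rw [hpq, (dTFunIter_jetPt (contMDiff_canonicalField s hL) s).2 _ hq']
  symm
  -- With `c = m - s + 1`, after `s` derivations the form sees the slots below `c + s = m + 1`, for
  -- every `s`.
  refine locDTFormIter_shift (c := m - s + 1) e.1.open_target (smoothForm_vertDiff _ hL e)
    (locForm_vertDiff_semibasic hL (by omega)) ?_ (by omega) s _ hq' _ ?_
  -- `J_{s+1}` reads only slots where `w` is the shift of `q`, so it sends every such `w` to
  -- `Δ_{s+1}`.
  · intro q hq w hw
    rw [locForm_vertDiff _ hL hq, ContinuousLinearMap.comp_apply]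
    refine Eq.trans ?_ (canonicalField_jetPt _ hL hq).symm
    congr 1
    funext i
    rw [vertL_apply, deltaL_apply]
    rcases lt_or_ge (i : ℕ) (s + 1) with hi | hi
    · rw [Nat.descFactorial_of_lt hi]; simp
    · rw [hw ⟨i - (s + 1), by omega⟩ (by simp; omega) (by simp; omega)]
      congr 3
      simp; omega
  -- The zero lift agrees with the shift of `q` in the slots up to `m`, which is all that is
  -- required.
  · intro i hi hi'
    have him : (i : ℕ) < m + 1 := by omega
    exact zeroL_apply (by omega : m ≤ 2 * m + 1) (shiftL E (by omega) q) ⟨i, by omega⟩ him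

/-- The highest momentum is `∂L/∂q_{m+1}`. -/
lemma lagrangianForm_top (hL : ContMDiff (jetI E (m + 1)) 𝓘(ℝ, ℝ) ∞ L)
    (p : Jet E Q (2 * m + 1)) (v : JetModel E (2 * m + 1))
    (hv : ∀ i : Fin (2 * m + 1 + 1), (i : ℕ) < m → v i = 0) :
    covec (lagrangianForm L) p v = covec (dForm L) (p.proj (by omega))
      (Pi.single (Fin.last (m + 1)) (v ⟨m, by omega⟩)) := by
  have hp := base_mem_baseChart (E := E) p.base
  have hq := jetChart_mem (k := 2 * m + 1) hp
  have hm : m + 1 ≤ 2 * m + 1 := by omega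
  have hd : covec (dForm L) (p.proj hm) = fderiv ℝ (L ∘ jetPt (m + 1) (baseChart E p.base))
      (truncL E hm (jetChart (2 * m + 1) (baseChart E p.base) p)) := by
    rw [mfderiv_eq_fderiv_jetPt (hL.mdifferentiableAt (by simp)), base_proj, jetChart_proj _ hp]
  rw [lagrangianForm_apply hL, hd]
  set e := baseChart E p.base with he
  set q := jetChart (2 * m + 1) e p with hqdef
  -- The form moves slot `m` down to `m - s`, and `J_{s+1}` moves it up to `m + 1` with the factor
  -- `(m+1)!/(m-s)!`. Division by `(s+1)!` leaves a binomial coefficient.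
  have hterm : ∀ s : Fin (m + 1),
      ((-1 : ℝ) ^ (s : ℕ) / ((s : ℕ) + 1).factorial) *
        locDTFormIter (locForm e (vertDiff ((s : ℕ) + 1) L)) s
          (truncL E (by omega) q) (truncL E (by omega) v) =
      ((-1 : ℝ) ^ (s : ℕ) * (m + 1).choose (s + 1)) *
        fderiv ℝ (L ∘ jetPt (m + 1) e) (truncL E hm q)
          (Pi.single (Fin.last (m + 1)) (v ⟨m, by omega⟩)) := by
    intro s
    have hms : m + 1 + s ≤ 2 * m + 1 := by omega
    have hq' : truncL E hms q ∈ cyl (m + 1 + s) e.1.target := hq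
    rw [locDTFormIter_top (c := m - s) e.1.open_target (smoothForm_vertDiff _ hL e)
      (locForm_vertDiff_semibasic hL (by omega)) (by omega) s _ hq'
      (truncL E hms v) (fun i hi => hv ⟨i, by omega⟩ (show (i : ℕ) < m by omega))]
    have hq1 : truncL E (Nat.le_add_right (m + 1) s) (truncL E hms q) ∈
        cyl (m + 1) e.1.target := hq
    rw [locForm_vertDiff _ hL hq1, ContinuousLinearMap.comp_apply]
    have hvert : vertL E (m + 1) (s + 1) (Pi.single ⟨m - s, by omega⟩
        (truncL E hms v ⟨m - s + s, by omega⟩)) =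
        ((m + 1).descFactorial (s + 1) : ℝ) •
          (Pi.single (Fin.last (m + 1)) (v ⟨m, by omega⟩) : JetModel E (m + 1)) := by
      have hms' : m - (s : ℕ) + s = m := by omega
      funext i
      rw [vertL_apply, Pi.smul_apply]
      by_cases hi : i = Fin.last (m + 1)
      · subst hi
        have : (⟨(Fin.last (m + 1) : ℕ) - (s + 1), by omega⟩ : Fin (m + 1 + 1)) =
            ⟨m - s, by omega⟩ := Fin.ext (by simp)
        rw [this]
        simp [hms']
      · have hi' : (i : ℕ) < m + 1 := by
          have := Fin.val_lt_last hi
          simpa using this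
        rw [Pi.single_eq_of_ne hi, smul_zero]
        rcases lt_or_ge (i : ℕ) (s + 1) with h | h
        · rw [Nat.descFactorial_of_lt h]; simp
        · rw [Pi.single_eq_of_ne, smul_zero]
          intro h'
          have := congrArg Fin.val h'
          simp at this
          omega
    rw [hvert, map_smul, smul_eq_mul, ← mul_assoc]
    congr 1
    rw [Nat.descFactorial_eq_factorial_mul_choose]
    push_cast
    field_simp [Nat.factorial_ne_zero]
  rw [Finset.sum_congr rfl fun s _ => hterm s, ← Finset.sum_mul]
  -- The full alternating sum of the binomial coefficients of `m + 1` vanishes; splitting off its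
  -- term at index 0 and changing sign leaves 1.
  have hsum : ∑ s : Fin (m + 1), ((-1 : ℝ) ^ (s : ℕ) * (m + 1).choose (s + 1)) = 1 := by
    rw [Fin.sum_univ_eq_sum_range (fun s => (-1 : ℝ) ^ s * ((m + 1).choose (s + 1) : ℝ)) (m + 1)]
    have h := Int.alternating_sum_range_choose (n := m + 1)
    rw [Finset.sum_range_succ', if_neg (by omega)] at h
    have h' : ∑ s ∈ Finset.range (m + 1), (-1 : ℤ) ^ s * ((m + 1).choose (s + 1) : ℤ) = 1 := by
      have : ∑ s ∈ Finset.range (m + 1), (-1 : ℤ) ^ s * ((m + 1).choose (s + 1) : ℤ) =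
          -∑ s ∈ Finset.range (m + 1), (-1 : ℤ) ^ (s + 1) * ((m + 1).choose (s + 1) : ℤ) := by
        rw [← Finset.sum_neg_distrib]
        exact Finset.sum_congr rfl fun s _ => by ring
      rw [this]
      simp at h ⊢
      linarith
    exact_mod_cast h'
  rw [hsum, one_mul]

end Momenta

/-! ### Charts of `T^*(T^m Q)` and `W`; the canonical forms and `pr₂` in coordinates. -/

section PhaseSpaces

variable {E : Type*} [NormedAddCommGroup E] [NormedSpace ℝ E]
  {Q : Type*} [TopologicalSpace Q] [ChartedSpace E Q] [IsManifold 𝓘(ℝ, E) ∞ Q]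
  {e : atlas E Q} {m : ℕ}

/-- The fibre coordinate of a covector induced by a chart of `Q`. -/
def cotCoord (e : atlas E Q) (β : Cotangent E Q m) : JetModel E m →L[ℝ] ℝ :=
  (show JetModel E m →L[ℝ] ℝ from β.2).comp
    (fderiv ℝ (jetTrans m e (baseChart E β.1.base)) (jetChart m e β.1))

/-- The trivialization of the bundle of homomorphisms precomposes with the inverse of the tangent
trivialization, which is the derivative of a transition. -/
lemma trivializationAt_cotangent (x₀ : Jet E Q m) {β : Cotangent E Q m}
    (hβ : β.1.base ∈ (baseChart E x₀.base).1.source) :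
    (trivializationAt (JetModel E m →L[ℝ] ℝ) (CotangentFibre E Q m) x₀ β).2 =
      cotCoord (baseChart E x₀.base) β := by
  have h := hom_trivializationAt_apply (RingHom.id ℝ) (F₁ := JetModel E m)
    (E₁ := (TangentSpace (jetI E m) : Jet E Q m → Type _)) (F₂ := ℝ)
    (E₂ := Bundle.Trivial (Jet E Q m) ℝ) x₀ β
  refine (congrArg Prod.snd h).trans ?_
  have hq := jetChart_mem (k := m) hβ
  have h1 : (Bundle.Trivialization.symmL ℝ
      (trivializationAt (JetModel E m) (TangentSpace (jetI E m)) x₀) β.1 :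
      JetModel E m →L[ℝ] JetModel E m) =
      fderiv ℝ (jetTrans m (baseChart E x₀.base) (baseChart E β.1.base))
        (jetChart m (baseChart E x₀.base) β.1) := by
    refine (TangentBundle.symmL_trivializationAt (I := jetI E m) (x₀ := x₀) (x := β.1) hβ).trans ?_
    rw [coe_extChartAt_jet, coe_extChartAt_jet_symm]
    simp only [mfld_simps, mfderivWithin_univ]
    refine (mfderiv_jetPt hq).trans ?_
    rw [jetPt_jetChart hβ]
  simp only [ContinuousLinearMap.inCoordinates]
  rw [cotCoord, ← h1]
  simp
  rfl

lemma extChartAt_cotangent (α : Cotangent E Q m) {β : Cotangent E Q m}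
    (hβ : β.1.base ∈ (baseChart E α.1.base).1.source) :
    extChartAt (cotI E m) α β =
      (jetChart m (baseChart E α.1.base) β.1, cotCoord (baseChart E α.1.base) β) := by
  rw [← trivializationAt_cotangent α.1 hβ, FiberBundle.extChartAt]
  simp only [mfld_simps]
  rfl

lemma base_mem_of_mem_source_cotangent {α β : Cotangent E Q m}
    (hβ : β ∈ (extChartAt (cotI E m) α).source) :
    β.1.base ∈ (baseChart E α.1.base).1.source := by
  rw [FiberBundle.extChartAt] at hβ
  simp only [mfld_simps] at hβ
  exact hβ.1.1

lemma extChartAt_unified (w₀ : Unified E Q m) {w : Unified E Q m}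
    (hw : w.1.base ∈ (baseChart E w₀.1.base).1.source) :
    extChartAt (uniI E m) w₀ w =
      (jetChart (2 * m + 1) (baseChart E w₀.1.base) w.1,
        cotCoord (baseChart E w₀.1.base) (pr2 w)) := by
  have h := trivializationAt_cotangent (E := E) (w₀.1.proj (by omega : m ≤ 2 * m + 1))
    (β := pr2 w) (by rw [base_proj]; exact (base_proj (by omega : m ≤ 2 * m + 1) w.1) ▸ hw)
  rw [base_proj] at h
  rw [← h, FiberBundle.extChartAt]
  simp only [mfld_simps]
  rfl

lemma base_mem_of_mem_source_unified {w₀ w : Unified E Q m}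
    (hw : w ∈ (extChartAt (uniI E m) w₀).source) :
    w.1.base ∈ (baseChart E w₀.1.base).1.source := by
  rw [FiberBundle.extChartAt] at hw
  simp only [mfld_simps] at hw
  exact hw.2

/-- The points of the chart of `T^*(T^m Q)` at `α`, in coordinates. -/
lemma cotangent_symm {α : Cotangent E Q m} {y : JetModel E m × (JetModel E m →L[ℝ] ℝ)}
    (hy : y ∈ (extChartAt (cotI E m) α).target) :
    y.1 ∈ cyl m (baseChart E α.1.base).1.target ∧
      ((extChartAt (cotI E m) α).symm y).1 = jetPt m (baseChart E α.1.base) y.1 ∧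
      cotCoord (baseChart E α.1.base) ((extChartAt (cotI E m) α).symm y) = y.2 := by
  have hs := base_mem_of_mem_source_cotangent ((extChartAt (cotI E m) α).map_target hy)
  have h := extChartAt_cotangent α hs
  rw [(extChartAt (cotI E m) α).right_inv hy] at h
  have h1 : y.1 = _ := congrArg Prod.fst h
  have h2 : y.2 = _ := congrArg Prod.snd h
  refine ⟨h1 ▸ jetChart_mem hs, ?_, h2.symm⟩
  conv_rhs => rw [h1]
  exact (jetPt_jetChart hs).symm

lemma unified_symm {w₀ : Unified E Q m} {y : JetModel E (2 * m + 1) × (JetModel E m →L[ℝ] ℝ)}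
    (hy : y ∈ (extChartAt (uniI E m) w₀).target) :
    y.1 ∈ cyl (2 * m + 1) (baseChart E w₀.1.base).1.target ∧
      ((extChartAt (uniI E m) w₀).symm y).1 = jetPt (2 * m + 1) (baseChart E w₀.1.base) y.1 ∧
      cotCoord (baseChart E w₀.1.base) (pr2 ((extChartAt (uniI E m) w₀).symm y)) = y.2 := by
  have hs := base_mem_of_mem_source_unified ((extChartAt (uniI E m) w₀).map_target hy)
  have h := extChartAt_unified w₀ hs
  rw [(extChartAt (uniI E m) w₀).right_inv hy] at h
  have h1 : y.1 = _ := congrArg Prod.fst h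
  have h2 : y.2 = _ := congrArg Prod.snd h
  refine ⟨h1 ▸ jetChart_mem hs, ?_, h2.symm⟩
  conv_rhs => rw [h1]
  exact (jetPt_jetChart hs).symm

/-- The canonical `1`-form in coordinates: `∑ p_i dq_i`. -/
lemma canonicalOneForm_coord (α : Cotangent E Q m)
    {y : JetModel E m × (JetModel E m →L[ℝ] ℝ)} (hy : y ∈ (extChartAt (cotI E m) α).target) :
    (canonicalOneForm ((extChartAt (cotI E m) α).symm y)).comp
      (mfderiv 𝓘(ℝ, JetModel E m × (JetModel E m →L[ℝ] ℝ)) (cotI E m)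
        (extChartAt (cotI E m) α).symm y) =
      y.2.comp (ContinuousLinearMap.fst ℝ (JetModel E m) (JetModel E m →L[ℝ] ℝ)) := by
  obtain ⟨h1, h2, h3⟩ := cotangent_symm hy
  set β := (extChartAt (cotI E m) α).symm y with hβ
  set e := baseChart E α.1.base
  have hd : MDifferentiableAt 𝓘(ℝ, JetModel E m × (JetModel E m →L[ℝ] ℝ)) (cotI E m)
      (extChartAt (cotI E m) α).symm y :=
    ((contMDiffOn_extChartAt_symm (n := ∞) α).contMDiffAt
      ((isOpen_extChartAt_target α).mem_nhds hy)).mdifferentiableAt (by simp)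
  have hπ : MDifferentiableAt (cotI E m) (jetI E m) (fun β : Cotangent E Q m => β.1) β :=
    (Bundle.contMDiff_proj (CotangentFibre E Q m) (n := ∞)).mdifferentiableAt (by simp)
  have hcomp := mfderiv_comp y hπ hd
  have hev : (fun β : Cotangent E Q m => β.1) ∘ (extChartAt (cotI E m) α).symm =ᶠ[𝓝 y]
      jetPt m e ∘ Prod.fst := by
    filter_upwards [(isOpen_extChartAt_target α).mem_nhds hy] with y' hy'
    exact (cotangent_symm hy').2.1
  have hP : mfderiv 𝓘(ℝ, JetModel E m × (JetModel E m →L[ℝ] ℝ)) (jetI E m)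
      (jetPt m e ∘ Prod.fst) y =
      (fderiv ℝ (jetTrans m e (baseChart E (jetPt m e y.1).base)) y.1).comp
        (ContinuousLinearMap.fst ℝ (JetModel E m) (JetModel E m →L[ℝ] ℝ)) := by
    rw [mfderiv_comp (I' := 𝓘(ℝ, JetModel E m)) y
      ((contMDiffAt_jetPt h1).mdifferentiableAt (by simp))
      (mdifferentiableAt_iff_differentiableAt.2 differentiableAt_fst), mfderiv_eq_fderiv,
      fderiv_fst]
    exact congrArg (fun A : JetModel E m →L[ℝ] JetModel E m =>
      A.comp (ContinuousLinearMap.fst ℝ (JetModel E m) (JetModel E m →L[ℝ] ℝ))) (mfderiv_jetPt h1)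
  rw [hev.mfderiv_eq, hP] at hcomp
  have hc : cotCoord e β = (show JetModel E m →L[ℝ] ℝ from β.2).comp
      (fderiv ℝ (jetTrans m e (baseChart E (jetPt m e y.1).base)) y.1) := by
    rw [cotCoord, h2, jetChart_jetPt h1]
  rw [← h3, hc, ContinuousLinearMap.comp_assoc]
  exact congrArg (ContinuousLinearMap.comp (show JetModel E m →L[ℝ] ℝ from β.2)) hcomp.symm

lemma symplecticForm_apply (α : Cotangent E Q m)
    (u v : JetModel E m × (JetModel E m →L[ℝ] ℝ)) :
    symplecticForm α u v = v.2 u.1 - u.2 v.1 := by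
  -- In the chart the canonical form depends linearly on the point, so its derivative is the
  -- constant `A`, and antisymmetrization gives the canonical formula.
  let A : JetModel E m × (JetModel E m →L[ℝ] ℝ) →L[ℝ]
      (JetModel E m × (JetModel E m →L[ℝ] ℝ) →L[ℝ] ℝ) :=
    ((ContinuousLinearMap.compL ℝ (JetModel E m × (JetModel E m →L[ℝ] ℝ)) (JetModel E m) ℝ).flip
      (ContinuousLinearMap.fst ℝ (JetModel E m) (JetModel E m →L[ℝ] ℝ))).comp
      (ContinuousLinearMap.snd ℝ (JetModel E m) (JetModel E m →L[ℝ] ℝ))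
  have hev : (fun y => (canonicalOneForm ((extChartAt (cotI E m) α).symm y)).comp
      (mfderiv 𝓘(ℝ, JetModel E m × (JetModel E m →L[ℝ] ℝ)) (cotI E m)
        (extChartAt (cotI E m) α).symm y) : JetModel E m × (JetModel E m →L[ℝ] ℝ) →
        (JetModel E m × (JetModel E m →L[ℝ] ℝ) →L[ℝ] ℝ)) =ᶠ[𝓝 (extChartAt (cotI E m) α α)] A := by
    filter_upwards [extChartAt_target_mem_nhds α] with y hy
    exact canonicalOneForm_coord α hy
  have hD := hev.fderiv_eq (𝕜 := ℝ)
  rw [ContinuousLinearMap.fderiv] at hD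
  have key : ∀ D : JetModel E m × (JetModel E m →L[ℝ] ℝ) →L[ℝ]
      (JetModel E m × (JetModel E m →L[ℝ] ℝ) →L[ℝ] ℝ),
      fderiv ℝ (fun y => (canonicalOneForm ((extChartAt (cotI E m) α).symm y)).comp
      (mfderiv 𝓘(ℝ, JetModel E m × (JetModel E m →L[ℝ] ℝ)) (cotI E m)
        (extChartAt (cotI E m) α).symm y) : JetModel E m × (JetModel E m →L[ℝ] ℝ) →
        (JetModel E m × (JetModel E m →L[ℝ] ℝ) →L[ℝ] ℝ)) (extChartAt (cotI E m) α α) = D →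
      symplecticForm α u v = -(D u v - D v u) := by
    rintro _ rfl
    rfl
  rw [key _ hD]
  simp [A]

/-- Vertical test vectors `(0, f)` separate the base components, since the dual separates points;
horizontal ones `(x, 0)` separate the fibre components. -/
lemma symplecticForm_injective (α : Cotangent E Q m) {u u' : TangentSpace (cotI E m) α}
    (h : ∀ v, symplecticForm α u v = symplecticForm α u' v) : u = u' := by
  have h' : ∀ v : JetModel E m × (JetModel E m →L[ℝ] ℝ),
      v.2 (show JetModel E m × (JetModel E m →L[ℝ] ℝ) from u).1 -
        (show JetModel E m × (JetModel E m →L[ℝ] ℝ) from u).2 v.1 =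
      v.2 (show JetModel E m × (JetModel E m →L[ℝ] ℝ) from u').1 -
        (show JetModel E m × (JetModel E m →L[ℝ] ℝ) from u').2 v.1 := by
    intro v
    have := h v
    exact (symplecticForm_apply α u v).symm.trans (this.trans (symplecticForm_apply α u' v))
  refine Prod.ext ?_ ?_
  · refine (SeparatingDual.eq_iff_forall_dual_eq (R := ℝ)).2 fun f => ?_
    simpa using h' (0, f)
  · ext x
    simpa using h' (x, 0)

/-- The coordinate expression `(q, a) ↦ (q_0, …, q_m; a)` of `pr₂`. -/
def pr2L (E : Type*) [NormedAddCommGroup E] [NormedSpace ℝ E] (m : ℕ) :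
    JetModel E (2 * m + 1) × (JetModel E m →L[ℝ] ℝ) →L[ℝ]
      JetModel E m × (JetModel E m →L[ℝ] ℝ) :=
  (truncL E (by omega)).prodMap (ContinuousLinearMap.id ℝ _)

lemma contMDiff_pr1 : ContMDiff (uniI E m) (jetI E (2 * m + 1)) ∞
    (pr1 : Unified E Q m → Jet E Q (2 * m + 1)) :=
  Bundle.contMDiff_proj _

lemma contMDiff_pr2 : ContMDiff (uniI E m) (cotI E m) ∞
    (pr2 : Unified E Q m → Cotangent E Q m) := by
  intro w
  have h := Bundle.contMDiffAt_totalSpace.1 (contMDiffAt_id (I := uniI E m) (n := ∞) (x := w))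
  exact Bundle.contMDiffAt_totalSpace.2
    ⟨(contMDiff_proj (by omega)).contMDiffAt.comp w h.1, h.2⟩

lemma mfderiv_pr2 (w : Unified E Q m) :
    (mfderiv (uniI E m) (cotI E m) pr2 w : JetModel E (2 * m + 1) × (JetModel E m →L[ℝ] ℝ) →L[ℝ]
      JetModel E m × (JetModel E m →L[ℝ] ℝ)) = pr2L E m := by
  refine (contMDiff_pr2.mdifferentiableAt (x := w) (by simp)).mfderiv.trans ?_
  rw [ModelWithCorners.Boundaryless.range_eq_univ, fderivWithin_univ]
  have hev : writtenInExtChartAt (uniI E m) (cotI E m) w pr2 =ᶠ[𝓝 (extChartAt (uniI E m) w w)]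
      pr2L E m := by
    filter_upwards [extChartAt_target_mem_nhds w] with y hy
    obtain ⟨h1, h2, h3⟩ := unified_symm hy
    have hm : m ≤ 2 * m + 1 := by omega
    have hb : (pr2 w).1.base = w.1.base := base_proj hm w.1
    have hs := base_mem_of_mem_source_unified ((extChartAt (uniI E m) w).map_target hy)
    have hb' : (pr2 ((extChartAt (uniI E m) w).symm y)).1.base ∈
        (baseChart E (pr2 w).1.base).1.source := by
      rw [hb]; exact (base_proj hm ((extChartAt (uniI E m) w).symm y).1).symm ▸ hs
    rw [writtenInExtChartAt, Function.comp_apply, Function.comp_apply, extChartAt_cotangent _ hb',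
      hb, h3]
    refine Prod.ext ?_ rfl
    refine (jetChart_proj hm hs).trans ?_
    rw [h2, jetChart_jetPt h1]
    rfl
  rw [hev.fderiv_eq, ContinuousLinearMap.fderiv]

end PhaseSpaces

/-! ### The function `H`, its differential, and its restriction to `W_o`. -/

section Hamiltonian

variable {E : Type*} [NormedAddCommGroup E] [NormedSpace ℝ E]
  {Q : Type*} [TopologicalSpace Q] [ChartedSpace E Q] [IsManifold 𝓘(ℝ, E) ∞ Q]
  {e : atlas E Q} {m : ℕ} {L : Jet E Q (m + 1) → ℝ}

/-- In the pulled-back bundle the fibre coordinate of `graphMap L` is that of `FL`. -/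
lemma contMDiff_graphMap (hleg : ContMDiff (jetI E (2 * m + 1)) (cotI E m) ∞ (legendre L)) :
    ContMDiff (jetI E (2 * m + 1)) (uniI E m) ∞ (graphMap L) := fun p =>
  Bundle.contMDiffAt_totalSpace.2
    ⟨contMDiffAt_id, (Bundle.contMDiffAt_totalSpace.1 (hleg p)).2⟩

lemma graphMap_pr1 {w : Unified E Q m} (hw : w ∈ Wo L) : graphMap L (pr1 w) = w := by
  obtain ⟨p, a⟩ := w
  have h : a = (legendre L p).2 := by
    have := hw
    simp only [Wo, Set.mem_ofPred_eq, pr2, pr1, legendre] at this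
    exact eq_of_heq (Bundle.TotalSpace.mk.inj this).2
  rw [h]
  rfl

/-- The pairing has the same expression in any chart around the point, because the shift transforms
as a tangent vector. -/
lemma coupling_coord (w : Unified E Q m) (hw : w.1.base ∈ e.1.source) :
    coupling w = cotCoord e (pr2 w) (shiftL E (by omega) (jetChart (2 * m + 1) e w.1)) := by
  have hm : m ≤ 2 * m + 1 := by omega
  have hm' : m + 1 ≤ 2 * m + 1 := by omega
  have hq := jetChart_mem (k := 2 * m + 1) hw
  have hpt := jetPt_jetChart (k := 2 * m + 1) hw
  have ht := mem_transDomain_base hq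
  rw [hpt] at ht
  have hb : (pr2 w).1.base = w.1.base := base_proj hm w.1
  have hj : jetChart m e (pr2 w).1 = truncL E hm (jetChart (2 * m + 1) e w.1) :=
    jetChart_proj hm hw
  rw [cotCoord, hb, hj, ContinuousLinearMap.comp_apply, fderiv_jetTrans_shift hm' ht, jetTrans]
  have hc : jetChart (2 * m + 1) (baseChart E w.1.base)
      ((jetChart (2 * m + 1) e).symm (jetChart (2 * m + 1) e w.1)) =
      jetChart (2 * m + 1) (baseChart E w.1.base) w.1 := congrArg _ hpt
  rw [hc]
  rfl

/-- The function `H` in the chart of `W` at `w₀`. -/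
def hamCoord (L : Jet E Q (m + 1) → ℝ) (e : atlas E Q)
    (y : JetModel E (2 * m + 1) × (JetModel E m →L[ℝ] ℝ)) : ℝ :=
  y.2 (shiftL E (by omega) y.1) - (L ∘ jetPt (m + 1) e) (truncL E (by omega) y.1)

lemma unifiedHamiltonian_eventuallyEq (w₀ : Unified E Q m) :
    unifiedHamiltonian L =ᶠ[𝓝 w₀]
      hamCoord L (baseChart E w₀.1.base) ∘ extChartAt (uniI E m) w₀ := by
  filter_upwards [extChartAt_source_mem_nhds (I := uniI E m) w₀] with w hw
  have hs := base_mem_of_mem_source_unified hw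
  have hm : m + 1 ≤ 2 * m + 1 := by omega
  rw [Function.comp_apply, extChartAt_unified _ hs, hamCoord, unifiedHamiltonian,
    coupling_coord w hs, Function.comp_apply, ← proj_jetPt hm (jetChart_mem hs), jetPt_jetChart hs]
  rfl

lemma hasFDerivAt_hamCoord (hL : ContMDiff (jetI E (m + 1)) 𝓘(ℝ, ℝ) ∞ L)
    {y : JetModel E (2 * m + 1) × (JetModel E m →L[ℝ] ℝ)}
    (hy : y.1 ∈ cyl (2 * m + 1) e.1.target) :
    ∃ D : JetModel E (2 * m + 1) × (JetModel E m →L[ℝ] ℝ) →L[ℝ] ℝ,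
      HasFDerivAt (hamCoord L e) D y ∧ ∀ v, D v =
        v.2 (shiftL E (by omega) y.1) + y.2 (shiftL E (by omega) v.1) -
        fderiv ℝ (L ∘ jetPt (m + 1) e) (truncL E (by omega) y.1) (truncL E (by omega) v.1) := by
  have hm : m + 1 ≤ 2 * m + 1 := by omega
  have hy' : truncL E hm y.1 ∈ cyl (m + 1) e.1.target := hy
  have h1 : HasFDerivAt (fun y : JetModel E (2 * m + 1) × (JetModel E m →L[ℝ] ℝ) =>
      shiftL E hm y.1) ((shiftL E hm).comp (ContinuousLinearMap.fst ℝ _ _)) y :=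
    (shiftL E hm).hasFDerivAt.comp y hasFDerivAt_fst
  have h2 : HasFDerivAt (fun y : JetModel E (2 * m + 1) × (JetModel E m →L[ℝ] ℝ) =>
      truncL E hm y.1) ((truncL E hm).comp (ContinuousLinearMap.fst ℝ _ _)) y :=
    (truncL E hm).hasFDerivAt.comp y hasFDerivAt_fst
  have h3 := ((contDiffAt_comp_jetPt hL hy').differentiableAt (by simp)).hasFDerivAt.comp y h2
  refine ⟨_, (hasFDerivAt_snd.clm_apply h1).sub h3, fun v => ?_⟩
  simp [add_comm]

lemma mdifferentiableAt_unifiedHamiltonian (hL : ContMDiff (jetI E (m + 1)) 𝓘(ℝ, ℝ) ∞ L)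
    (w : Unified E Q m) :
    MDifferentiableAt (uniI E m) 𝓘(ℝ, ℝ) (unifiedHamiltonian L) w := by
  have hs := base_mem_of_mem_source_unified (mem_extChartAt_source (I := uniI E m) w)
  have hy : (extChartAt (uniI E m) w w).1 ∈
      cyl (2 * m + 1) (baseChart E w.1.base).1.target := by
    rw [extChartAt_unified _ hs]; exact jetChart_mem hs
  obtain ⟨D, hD, -⟩ := hasFDerivAt_hamCoord hL hy
  have h1 : MDifferentiableAt (uniI E m)
      𝓘(ℝ, JetModel E (2 * m + 1) × (JetModel E m →L[ℝ] ℝ)) (extChartAt (uniI E m) w) w :=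
    mdifferentiableAt_extChartAt (mem_chart_source _ w)
  exact (hD.differentiableAt.mdifferentiableAt.comp w h1).congr_of_eventuallyEq
    (unifiedHamiltonian_eventuallyEq w)

lemma mfderiv_unifiedHamiltonian (hL : ContMDiff (jetI E (m + 1)) 𝓘(ℝ, ℝ) ∞ L)
    (w : Unified E Q m) (v : JetModel E (2 * m + 1) × (JetModel E m →L[ℝ] ℝ)) :
    mfderiv (uniI E m) 𝓘(ℝ, ℝ) (unifiedHamiltonian L) w v =
      v.2 (shiftL E (by omega) (jetChart (2 * m + 1) (baseChart E w.1.base) w.1)) +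
        (show JetModel E m →L[ℝ] ℝ from (pr2 w).2) (shiftL E (by omega) v.1) -
        covec (dForm L) (w.1.proj (by omega)) (truncL E (by omega) v.1) := by
  have hm : m + 1 ≤ 2 * m + 1 := by omega
  have hm' : m ≤ 2 * m + 1 := by omega
  have hs := base_mem_of_mem_source_unified (mem_extChartAt_source (I := uniI E m) w)
  have hex := extChartAt_unified w hs
  have hy : (extChartAt (uniI E m) w w).1 ∈
      cyl (2 * m + 1) (baseChart E w.1.base).1.target := by
    rw [hex]; exact jetChart_mem hs
  obtain ⟨D, hD, hDv⟩ := hasFDerivAt_hamCoord hL hy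
  have hmf : ((mfderiv (uniI E m) 𝓘(ℝ, ℝ) (unifiedHamiltonian L) w :
      JetModel E (2 * m + 1) × (JetModel E m →L[ℝ] ℝ) →L[ℝ] ℝ)) = D := by
    refine (mdifferentiableAt_unifiedHamiltonian hL w).mfderiv.trans ?_
    rw [ModelWithCorners.Boundaryless.range_eq_univ, fderivWithin_univ, ← hD.fderiv]
    refine Filter.EventuallyEq.fderiv_eq ?_
    have ht := continuousAt_extChartAt_symm (I := uniI E m) w
    rw [ContinuousAt, extChartAt_to_inv] at ht
    filter_upwards [ht.eventually (unifiedHamiltonian_eventuallyEq (L := L) w),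
      extChartAt_target_mem_nhds (I := uniI E m) w] with y hy hyt
    simp only [writtenInExtChartAt, mfld_simps]
    refine hy.trans ?_
    rw [Function.comp_apply, (extChartAt (uniI E m) w).right_inv hyt]
  have hcot : cotCoord (baseChart E w.1.base) (pr2 w) =
      (show JetModel E m →L[ℝ] ℝ from (pr2 w).2) := by
    have hb : (pr2 w).1.base = w.1.base := base_proj hm' w.1
    have hj : jetChart m (baseChart E w.1.base) (pr2 w).1 ∈
        cyl m (baseChart E w.1.base).1.target := jetChart_mem (by rw [hb]; exact hs)
    rw [cotCoord, hb, fderiv_jetTrans_self hj]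
    rfl
  have hd : covec (dForm L) (w.1.proj hm) = fderiv ℝ (L ∘ jetPt (m + 1) (baseChart E w.1.base))
      (truncL E hm (jetChart (2 * m + 1) (baseChart E w.1.base) w.1)) := by
    rw [mfderiv_eq_fderiv_jetPt (hL.mdifferentiableAt (by simp)), base_proj, jetChart_proj _ hs]
  rw [hd, ← hcot]
  refine (congrArg (fun A : JetModel E (2 * m + 1) × (JetModel E m →L[ℝ] ℝ) →L[ℝ] ℝ => A v)
    hmf).trans ?_
  rw [hDv, hex]

/-- `dH` vanishes on the kernel of `Tpr₂` along `W_o`. -/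
lemma mfderiv_unifiedHamiltonian_eq_zero (hL : ContMDiff (jetI E (m + 1)) 𝓘(ℝ, ℝ) ∞ L)
    {w : Unified E Q m} (hw : w ∈ Wo L) {v : TangentSpace (uniI E m) w}
    (hv : mfderiv (uniI E m) (cotI E m) pr2 w v = 0) :
    mfderiv (uniI E m) 𝓘(ℝ, ℝ) (unifiedHamiltonian L) w v = 0 := by
  have hm : m + 1 ≤ 2 * m + 1 := by omega
  have hm' : m ≤ 2 * m + 1 := by omega
  obtain ⟨v₁, v₂⟩ : JetModel E (2 * m + 1) × (JetModel E m →L[ℝ] ℝ) := v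
  have hpr : pr2L E m (v₁, v₂) = 0 := by
    rw [← mfderiv_pr2 w]; exact hv
  have hv1 : truncL E hm' v₁ = 0 := congrArg Prod.fst hpr
  have hv2 : v₂ = 0 := congrArg Prod.snd hpr
  have hi : ∀ i : Fin (2 * m + 1 + 1), (i : ℕ) < m + 1 → v₁ i = 0 := fun i hi =>
    congrFun hv1 ⟨i, hi⟩
  refine (mfderiv_unifiedHamiltonian hL w (v₁, v₂)).trans ?_
  -- Only here is the point required to lie on `W_o`: its covector is the momentum given by `θ_L`.
  have hleg : ∀ u, (show JetModel E m →L[ℝ] ℝ from (pr2 w).2) u =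
      covec (lagrangianForm L) w.1 (zeroL E hm' u) := by
    intro u
    rw [← graphMap_pr1 hw]
    rfl
  -- Both the shift of `v₁` and its truncation carry the single component `v₁_{m+1}`, in slots `m`
  -- and `m + 1` respectively. The momentum term thus equals the `dL` term and cancels it.
  rw [hleg, lagrangianForm_top hL _ _ ?_, hv2]
  · have hlast : truncL E hm v₁ = Pi.single (Fin.last (m + 1)) (v₁ ⟨m + 1, by omega⟩) := by
      funext i
      by_cases h : i = Fin.last (m + 1)
      · subst h; simp
      · rw [Pi.single_eq_of_ne h]
        exact hi ⟨i, by omega⟩ (by simpa using Fin.val_lt_last h)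
    rw [hlast, zeroL_apply _ _ _ (by simp)]
    simp
    rfl
  · intro i him
    rw [zeroL_apply _ _ _ (by omega), shiftL_apply]
    exact hi _ (by simpa using him)

/-- The restriction of `H` to the graph of the Legendre-Ostrogradsky map is the energy. -/
lemma unifiedHamiltonian_graphMap (hL : ContMDiff (jetI E (m + 1)) 𝓘(ℝ, ℝ) ∞ L)
    (p : Jet E Q (2 * m + 1)) : unifiedHamiltonian L (graphMap L p) = energy L p :=
  (energy_eq hL p).symm

end Hamiltonian

/-! ### Push-forwards, and fields tangent to the graph of `FL`. -/

section VectorFields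

variable {E : Type*} [NormedAddCommGroup E] [NormedSpace ℝ E]
  {Q : Type*} [TopologicalSpace Q] [ChartedSpace E Q] [IsManifold 𝓘(ℝ, E) ∞ Q]
  {m : ℕ} {L : Jet E Q (m + 1) → ℝ}

section Pushforward

variable {F₁ H₁ M₁ F₂ H₂ M₂ : Type*} [NormedAddCommGroup F₁] [NormedSpace ℝ F₁]
  [TopologicalSpace H₁] [TopologicalSpace M₁] [ChartedSpace H₁ M₁]
  [NormedAddCommGroup F₂] [NormedSpace ℝ F₂]
  [TopologicalSpace H₂] [TopologicalSpace M₂] [ChartedSpace H₂ M₂]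
  {I₁ : ModelWithCorners ℝ F₁ H₁} {I₂ : ModelWithCorners ℝ F₂ H₂}

/-- The push-forward of a vector field by a map `f` with inverse `g`. -/
def pushField (I₁ : ModelWithCorners ℝ F₁ H₁) (I₂ : ModelWithCorners ℝ F₂ H₂) (f : M₁ → M₂)
    (g : M₂ → M₁) (Z : ∀ x : M₁, TangentSpace I₁ x) : ∀ y : M₂, TangentSpace I₂ y := fun y =>
  (show F₂ from mfderiv I₁ I₂ f (g y) (Z (g y)))

lemma pushField_apply {f : M₁ → M₂} {g : M₂ → M₁} (hgf : ∀ x, g (f x) = x)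
    (Z : ∀ x : M₁, TangentSpace I₁ x) (x : M₁) :
    pushField I₁ I₂ f g Z (f x) = mfderiv I₁ I₂ f x (Z x) :=
  congrArg (fun x' => (show F₂ from mfderiv I₁ I₂ f x' (Z x'))) (hgf x)

lemma isSmoothField_pushField [IsManifold I₁ 1 M₁] [IsManifold I₂ 1 M₂] {f : M₁ → M₂}
    {g : M₂ → M₁} (hf : ContMDiff I₁ I₂ ∞ f) (hg : ContMDiff I₂ I₁ ∞ g)
    (hfg : ∀ y, f (g y) = y) {Z : ∀ x : M₁, TangentSpace I₁ x} (hZ : IsSmoothField I₁ Z) :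
    IsSmoothField I₂ (pushField I₁ I₂ f g Z) := by
  have h1 : ContMDiff I₂ I₂.tangent ∞
      fun y => tangentMap I₁ I₂ f (⟨g y, Z (g y)⟩ : TangentBundle I₁ M₁) :=
    (hf.contMDiff_tangentMap (m := ∞) le_rfl).comp (hZ.comp hg)
  have h2 : ∀ (y y' : M₂) (v : F₂), y' = y →
      (⟨y, v⟩ : TangentBundle I₂ M₂) = ⟨y', v⟩ := by
    rintro y _ v rfl; rfl
  exact h1.congr fun y => h2 y _ _ (hfg y)

/-- The chain rule for `g ∘ f = id`. The values are compared in the model space because they lie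
over `g (f x)` and `x`, which are equal only propositionally. -/
lemma mfderiv_inverse_apply {f : M₁ → M₂} {g : M₂ → M₁} (hf : ContMDiff I₁ I₂ ∞ f)
    (hg : ContMDiff I₂ I₁ ∞ g) (hgf : ∀ x, g (f x) = x) (x : M₁) (v : TangentSpace I₁ x) :
    (show F₁ from mfderiv I₂ I₁ g (f x) (mfderiv I₁ I₂ f x v)) = (show F₁ from v) := by
  have h1 := mfderiv_comp x (hg.mdifferentiableAt (x := f x) (by simp))
    (hf.mdifferentiableAt (by simp))
  rw [show g ∘ f = id from funext hgf] at h1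
  have h2 := congrArg (fun A : F₁ →L[ℝ] F₁ => A (show F₁ from v))
    (h1.symm.trans (mfderiv_id (I := I₁)))
  exact h2

end Pushforward

lemma mfderiv_pr1_graphMap (hleg : ContMDiff (jetI E (2 * m + 1)) (cotI E m) ∞ (legendre L))
    (p : Jet E Q (2 * m + 1)) (u : TangentSpace (jetI E (2 * m + 1)) p) :
    mfderiv (uniI E m) (jetI E (2 * m + 1)) pr1 (graphMap L p)
      (mfderiv (jetI E (2 * m + 1)) (uniI E m) (graphMap L) p u) = u :=
  mfderiv_inverse_apply (contMDiff_graphMap hleg) contMDiff_pr1 (fun _ => rfl) p u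

lemma mfderiv_pr2_graphMap (hleg : ContMDiff (jetI E (2 * m + 1)) (cotI E m) ∞ (legendre L))
    (p : Jet E Q (2 * m + 1)) (u : TangentSpace (jetI E (2 * m + 1)) p) :
    mfderiv (uniI E m) (cotI E m) pr2 (graphMap L p)
      (mfderiv (jetI E (2 * m + 1)) (uniI E m) (graphMap L) p u) =
      mfderiv (jetI E (2 * m + 1)) (cotI E m) (legendre L) p u := by
  have h1 := mfderiv_comp p (contMDiff_pr2.mdifferentiableAt (x := graphMap L p) (by simp))
    ((contMDiff_graphMap hleg).mdifferentiableAt (by simp))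
  exact congrArg (fun A : JetModel E (2 * m + 1) →L[ℝ] JetModel E m × (JetModel E m →L[ℝ] ℝ) =>
    A u) h1.symm

/-- `Tpr₁` is a left inverse of the derivative of `graphMap L`, so the vector witnessing tangency
can only be the value of `X_L`. -/
lemma apply_graphMap_of_tangentToWo
    (hleg : ContMDiff (jetI E (2 * m + 1)) (cotI E m) ∞ (legendre L)) {X : FieldOnWo L}
    (hX : TangentToWo X) (p : Jet E Q (2 * m + 1)) :
    X ⟨graphMap L p, graphMap_mem L p⟩ =
      mfderiv (jetI E (2 * m + 1)) (uniI E m) (graphMap L) p (lagrangianField X p) := by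
  obtain ⟨u, hu⟩ := hX ⟨graphMap L p, graphMap_mem L p⟩
  have h : lagrangianField X p = u := by
    rw [lagrangianField, hu]
    exact mfderiv_pr1_graphMap hleg p u
  rw [h]
  exact hu

/-- Locally `X_L` is `Tpr₁ ∘ Y ∘ graphMap L` with `Y` a smooth extension of `X` to an open subset of
`W`. -/
lemma isSmoothField_lagrangianField
    (hleg : ContMDiff (jetI E (2 * m + 1)) (cotI E m) ∞ (legendre L)) {X : FieldOnWo L}
    (hX : IsSmoothFieldOn (uniI E m) (Wo L) X) :
    IsSmoothField (jetI E (2 * m + 1)) (lagrangianField X) := by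
  intro p
  obtain ⟨U, hU, hpU, Y, hY, hYX⟩ := hX (graphMap L p) (graphMap_mem L p)
  have hg := contMDiff_graphMap hleg
  have h1 : ContMDiffAt (jetI E (2 * m + 1)) (uniI E m).tangent ∞
      (fun p' => (⟨graphMap L p', Y (graphMap L p')⟩ : TangentBundle (uniI E m) (Unified E Q m)))
      p := (hY.contMDiffAt (hU.mem_nhds hpU)).comp p hg.contMDiffAt
  have h2 := ((contMDiff_pr1 (E := E) (Q := Q) (m := m)).contMDiff_tangentMap (m := ∞)
    le_rfl).contMDiffAt.comp p h1
  refine h2.congr_of_eventuallyEq ?_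
  filter_upwards [hg.continuous.continuousAt.eventually (hU.mem_nhds hpU)] with p' hp'
  have h3 := hYX ⟨graphMap L p', graphMap_mem L p'⟩ hp'
  simp only [Function.comp_apply, tangentMap, lagrangianField, ← h3]
  rfl

lemma mfderiv_unifiedHamiltonian_graphMap (hL : ContMDiff (jetI E (m + 1)) 𝓘(ℝ, ℝ) ∞ L)
    (hleg : ContMDiff (jetI E (2 * m + 1)) (cotI E m) ∞ (legendre L))
    {h : Cotangent E Q m → ℝ} (hh : ContMDiff (cotI E m) 𝓘(ℝ, ℝ) ∞ h)
    (hE : ∀ p : Jet E Q (2 * m + 1), h (legendre L p) = energy L p)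
    (p : Jet E Q (2 * m + 1)) (u : TangentSpace (jetI E (2 * m + 1)) p) :
    (show ℝ from mfderiv (uniI E m) 𝓘(ℝ, ℝ) (unifiedHamiltonian L) (graphMap L p)
      (mfderiv (jetI E (2 * m + 1)) (uniI E m) (graphMap L) p u)) =
    (show ℝ from mfderiv (cotI E m) 𝓘(ℝ, ℝ) h (legendre L p)
      (mfderiv (jetI E (2 * m + 1)) (cotI E m) (legendre L) p u)) := by
  have h1 := mfderiv_comp p (mdifferentiableAt_unifiedHamiltonian hL (graphMap L p))
    ((contMDiff_graphMap hleg).mdifferentiableAt (by simp))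
  have h2 := mfderiv_comp p (hh.mdifferentiableAt (x := legendre L p) (by simp))
    (hleg.mdifferentiableAt (by simp))
  have h3 : unifiedHamiltonian L ∘ graphMap L = h ∘ legendre L :=
    funext fun p => (unifiedHamiltonian_graphMap hL p).trans (hE p).symm
  rw [h3] at h1
  exact congrArg (fun A : JetModel E (2 * m + 1) →L[ℝ] ℝ => A u) (h1.symm.trans h2)

/-- The pullback of the unified equation to `W_o`: `pr2 ∘ graphMap L = FL` turns `Ω` into `ω`, and
the energy identity turns `dH` into `dh`. -/
lemma solvesHamilton_apply (hL : ContMDiff (jetI E (m + 1)) 𝓘(ℝ, ℝ) ∞ L)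
    (hleg : ContMDiff (jetI E (2 * m + 1)) (cotI E m) ∞ (legendre L))
    {h : Cotangent E Q m → ℝ} (hh : ContMDiff (cotI E m) 𝓘(ℝ, ℝ) ∞ h)
    (hE : ∀ p : Jet E Q (2 * m + 1), h (legendre L p) = energy L p)
    {X : FieldOnWo L} (hX : TangentToWo X) (hXs : SolvesUnified X)
    (p : Jet E Q (2 * m + 1)) (u : TangentSpace (jetI E (2 * m + 1)) p) :
    symplecticForm (legendre L p)
      (mfderiv (jetI E (2 * m + 1)) (cotI E m) (legendre L) p (lagrangianField X p))
      (mfderiv (jetI E (2 * m + 1)) (cotI E m) (legendre L) p u) =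
    mfderiv (cotI E m) 𝓘(ℝ, ℝ) h (legendre L p)
      (mfderiv (jetI E (2 * m + 1)) (cotI E m) (legendre L) p u) := by
  have h1 := hXs ⟨graphMap L p, graphMap_mem L p⟩
    (mfderiv (jetI E (2 * m + 1)) (uniI E m) (graphMap L) p u)
  rw [apply_graphMap_of_tangentToWo hleg hX, presymplecticForm] at h1
  have h2 := h1.trans (mfderiv_unifiedHamiltonian_graphMap hL hleg hh hE p u)
  exact (congrArg₂ (fun a b : JetModel E m × (JetModel E m →L[ℝ] ℝ) =>
    symplecticForm (legendre L p) a b) (mfderiv_pr2_graphMap hleg p (lagrangianField X p))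
    (mfderiv_pr2_graphMap hleg p u)).symm.trans h2

/-- The field `Z` of `T^{2m+1} Q` lifted to the graph of the Legendre-Ostrogradsky map. -/
def graphField (L : Jet E Q (m + 1) → ℝ)
    (Z : ∀ p : Jet E Q (2 * m + 1), TangentSpace (jetI E (2 * m + 1)) p) : FieldOnWo L := fun w =>
  (show JetModel E (2 * m + 1) × (JetModel E m →L[ℝ] ℝ) from
    mfderiv (jetI E (2 * m + 1)) (uniI E m) (graphMap L) (pr1 w.1) (Z (pr1 w.1)))

lemma lagrangianField_graphField
    (hleg : ContMDiff (jetI E (2 * m + 1)) (cotI E m) ∞ (legendre L))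
    (Z : ∀ p : Jet E Q (2 * m + 1), TangentSpace (jetI E (2 * m + 1)) p) :
    lagrangianField (graphField L Z) = Z :=
  funext fun p => mfderiv_pr1_graphMap hleg p (Z p)

lemma tangentToWo_graphField (Z : ∀ p : Jet E Q (2 * m + 1), TangentSpace (jetI E (2 * m + 1)) p) :
    TangentToWo (graphField L Z) := fun w => ⟨Z (pr1 w.1), rfl⟩

/-- A vector field along a retraction onto `S` extends, near each point of `S`, to a smooth vector
field. -/
lemma isSmoothFieldOn_of_retraction {F H M : Type*} [NormedAddCommGroup F] [NormedSpace ℝ F]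
    [TopologicalSpace H] [TopologicalSpace M] [ChartedSpace H M] (I : ModelWithCorners ℝ F H)
    [IsManifold I ∞ M] [IsManifold I 1 M] {S : Set M} {r : M → M} (hr : ∀ x ∈ S, r x = x)
    {Y : M → F} {X : ∀ x : S, TangentSpace I (x : M)} (hXY : ∀ x : S, X x = Y x)
    (hrc : Continuous r)
    (hY : ContMDiff I I.tangent ∞ fun x => (⟨r x, Y x⟩ : TangentBundle I M)) :
    IsSmoothFieldOn I S X := by
  intro x₀ hx₀
  -- `Y x` is a vector over `r x` rather than over `x`. It is transported to `x` by keeping its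
  -- fibre coordinate in a trivialization, which changes nothing on `S`, where `r x = x`.
  let t := trivializationAt F (TangentSpace I : M → Type _) x₀
  refine ⟨t.baseSet ∩ r ⁻¹' t.baseSet, t.open_baseSet.inter (t.open_baseSet.preimage hrc),
    ⟨FiberBundle.mem_baseSet_trivializationAt' x₀, ?_⟩,
    fun x => t.symm x (t ⟨r x, Y x⟩).2, ?_, ?_⟩
  · rw [Set.mem_preimage, hr x₀ hx₀]
    exact FiberBundle.mem_baseSet_trivializationAt' x₀
  · have hmaps : Set.MapsTo (fun x => (⟨r x, Y x⟩ : TangentBundle I M))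
        (t.baseSet ∩ r ⁻¹' t.baseSet) t.source := fun x hx => t.mem_source.2 hx.2
    have h1 := ((t.contMDiffOn_iff (n := ∞) (IM := I) (IB := I) hmaps).1 hY.contMDiffOn).2
    refine (t.contMDiffOn_iff fun x hx => t.mem_source.2 hx.1).2 ⟨contMDiffOn_id, ?_⟩
    exact h1.congr fun x hx => by rw [t.apply_mk_symm hx.1]
  · intro y hy
    have h1 : ∀ (z : M), z = y → (t (⟨z, Y y⟩ : TangentBundle I M)).2 =
        (t (⟨y, X y⟩ : TangentBundle I M)).2 := by
      rintro z rfl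
      rw [hXY]
    simp only []
    rw [h1 _ (hr y y.2)]
    exact t.symm_apply_apply_mk hy.1 (X y)

lemma isSmoothFieldOn_graphField
    (hleg : ContMDiff (jetI E (2 * m + 1)) (cotI E m) ∞ (legendre L))
    {Z : ∀ p : Jet E Q (2 * m + 1), TangentSpace (jetI E (2 * m + 1)) p}
    (hZ : IsSmoothField (jetI E (2 * m + 1)) Z) :
    IsSmoothFieldOn (uniI E m) (Wo L) (graphField L Z) := by
  have hg := contMDiff_graphMap hleg
  have h1 : ContMDiff (uniI E m) (uniI E m).tangent ∞ fun w : Unified E Q m =>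
      tangentMap (jetI E (2 * m + 1)) (uniI E m) (graphMap L)
        (⟨pr1 w, Z (pr1 w)⟩ : TangentBundle (jetI E (2 * m + 1)) (Jet E Q (2 * m + 1))) :=
    (hg.contMDiff_tangentMap (m := ∞) le_rfl).comp (hZ.comp contMDiff_pr1)
  exact isSmoothFieldOn_of_retraction (uniI E m) (r := graphMap L ∘ pr1)
    (Y := fun w => (show JetModel E (2 * m + 1) × (JetModel E m →L[ℝ] ℝ) from
      mfderiv (jetI E (2 * m + 1)) (uniI E m) (graphMap L) (pr1 w) (Z (pr1 w))))
    (fun w hw => graphMap_pr1 hw) (fun w => rfl)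
    (hg.continuous.comp contMDiff_pr1.continuous) h1

end VectorFields

/-! ### Passage between the unified equation and Hamilton's equation. -/

section Equivalence

variable {E : Type*} [NormedAddCommGroup E] [NormedSpace ℝ E]
  {Q : Type*} [TopologicalSpace Q] [ChartedSpace E Q] [IsManifold 𝓘(ℝ, E) ∞ Q]
  {m : ℕ} {L : Jet E Q (m + 1) → ℝ} {G : Cotangent E Q m → Jet E Q (2 * m + 1)}

lemma exists_mfderiv_legendre
    (hleg : ContMDiff (jetI E (2 * m + 1)) (cotI E m) ∞ (legendre L))
    (hG : ContMDiff (cotI E m) (jetI E (2 * m + 1)) ∞ G)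
    (hGl : ∀ p, G (legendre L p) = p) (hlG : ∀ α, legendre L (G α) = α)
    (p : Jet E Q (2 * m + 1)) (v : TangentSpace (cotI E m) (legendre L p)) :
    ∃ u : TangentSpace (jetI E (2 * m + 1)) p,
      mfderiv (jetI E (2 * m + 1)) (cotI E m) (legendre L) p u = v := by
  -- The preimage is `TG v`, a vector over `G (legendre L p)`; the equality of that point with `p`
  -- carries it over.
  have h : ∀ p', p' = p → ∀ u : JetModel E (2 * m + 1),
      (show JetModel E m × (JetModel E m →L[ℝ] ℝ) from
        mfderiv (jetI E (2 * m + 1)) (cotI E m) (legendre L) p' u) = v →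
      ∃ u : TangentSpace (jetI E (2 * m + 1)) p,
        mfderiv (jetI E (2 * m + 1)) (cotI E m) (legendre L) p u = v := by
    rintro _ rfl u hu
    exact ⟨u, hu⟩
  exact h _ (hGl p) _ (mfderiv_inverse_apply hG hleg hlG (legendre L p) v)

lemma mfderiv_legendre_injective
    (hleg : ContMDiff (jetI E (2 * m + 1)) (cotI E m) ∞ (legendre L))
    (hG : ContMDiff (cotI E m) (jetI E (2 * m + 1)) ∞ G)
    (hGl : ∀ p, G (legendre L p) = p) (p : Jet E Q (2 * m + 1)) :
    Function.Injective (mfderiv (jetI E (2 * m + 1)) (cotI E m) (legendre L) p) := by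
  intro u u' h
  have h1 := mfderiv_inverse_apply hleg hG hGl p u
  rw [h] at h1
  exact h1.symm.trans (mfderiv_inverse_apply hleg hG hGl p u')

/-- The pull-back of a field by the Legendre-Ostrogradsky map is related to the field. -/
lemma isLegendrePushforward_pullback
    (hleg : ContMDiff (jetI E (2 * m + 1)) (cotI E m) ∞ (legendre L))
    (hG : ContMDiff (cotI E m) (jetI E (2 * m + 1)) ∞ G)
    (hGl : ∀ p, G (legendre L p) = p) (hlG : ∀ α, legendre L (G α) = α)
    (Y : ∀ α : Cotangent E Q m, TangentSpace (cotI E m) α) :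
    IsLegendrePushforward L (pushField (cotI E m) (jetI E (2 * m + 1)) G (legendre L) Y) Y := by
  intro p
  obtain ⟨u, hu⟩ := exists_mfderiv_legendre hleg hG hGl hlG p (Y (legendre L p))
  have h1 : pushField (cotI E m) (jetI E (2 * m + 1)) G (legendre L) Y p = u := by
    rw [pushField, ← hu]
    exact mfderiv_inverse_apply hleg hG hGl p u
  rw [h1, hu]

/-- The lift to `W_o` of a field related to a solution of Hamilton's equation solves the unified
equation. -/
lemma solvesUnified_graphField (hL : ContMDiff (jetI E (m + 1)) 𝓘(ℝ, ℝ) ∞ L)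
    (hleg : ContMDiff (jetI E (2 * m + 1)) (cotI E m) ∞ (legendre L))
    (hG : ContMDiff (cotI E m) (jetI E (2 * m + 1)) ∞ G)
    (hGl : ∀ p, G (legendre L p) = p) (hlG : ∀ α, legendre L (G α) = α)
    {h : Cotangent E Q m → ℝ} (hh : ContMDiff (cotI E m) 𝓘(ℝ, ℝ) ∞ h)
    (hE : ∀ p : Jet E Q (2 * m + 1), h (legendre L p) = energy L p)
    {Z : ∀ p : Jet E Q (2 * m + 1), TangentSpace (jetI E (2 * m + 1)) p}
    {Y : ∀ α : Cotangent E Q m, TangentSpace (cotI E m) α}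
    (hZY : IsLegendrePushforward L Z Y) (hY : SolvesHamilton h Y) :
    SolvesUnified (graphField L Z) := by
  rintro ⟨w, hw⟩ v
  obtain ⟨p, rfl⟩ : ∃ p, graphMap L p = w := ⟨_, graphMap_pr1 hw⟩
  obtain ⟨u, hu⟩ := exists_mfderiv_legendre hleg hG hGl hlG p
    (mfderiv (uniI E m) (cotI E m) pr2 (graphMap L p) v)
  have hX : mfderiv (uniI E m) (cotI E m) pr2 (graphMap L p) (graphField L Z ⟨_, hw⟩) =
      Y (legendre L p) := (mfderiv_pr2_graphMap hleg p (Z p)).trans (hZY p).symm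
  -- The difference of two vectors with equal image under `Tpr₂` is annihilated by `dH` on `W_o`, so
  -- `v` may be replaced by a vector tangent to the graph.
  have hker : mfderiv (uniI E m) 𝓘(ℝ, ℝ) (unifiedHamiltonian L) (graphMap L p)
      (v - mfderiv (jetI E (2 * m + 1)) (uniI E m) (graphMap L) p u) = 0 := by
    refine mfderiv_unifiedHamiltonian_eq_zero hL hw ?_
    rw [map_sub, sub_eq_zero]
    exact (mfderiv_pr2_graphMap hleg p u |>.trans hu).symm
  rw [map_sub, sub_eq_zero] at hker
  have h1 : presymplecticForm (graphMap L p) (graphField L Z ⟨_, hw⟩) v =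
      symplecticForm (legendre L p) (Y (legendre L p))
        (mfderiv (jetI E (2 * m + 1)) (cotI E m) (legendre L) p u) :=
    congrArg₂ (fun a b : JetModel E m × (JetModel E m →L[ℝ] ℝ) =>
      symplecticForm (legendre L p) a b) hX hu.symm
  exact h1.trans ((hY _ _).trans
    ((mfderiv_unifiedHamiltonian_graphMap hL hleg hh hE p u).symm.trans hker.symm))

/-- A tangent solution of the unified equation pushes forward to every solution of Hamilton's
equation. -/
lemma isLegendrePushforward_of_solvesUnified (hL : ContMDiff (jetI E (m + 1)) 𝓘(ℝ, ℝ) ∞ L)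
    (hleg : ContMDiff (jetI E (2 * m + 1)) (cotI E m) ∞ (legendre L))
    (hG : ContMDiff (cotI E m) (jetI E (2 * m + 1)) ∞ G)
    (hGl : ∀ p, G (legendre L p) = p) (hlG : ∀ α, legendre L (G α) = α)
    {h : Cotangent E Q m → ℝ} (hh : ContMDiff (cotI E m) 𝓘(ℝ, ℝ) ∞ h)
    (hE : ∀ p : Jet E Q (2 * m + 1), h (legendre L p) = energy L p)
    {X : FieldOnWo L} (hX : TangentToWo X) (hXs : SolvesUnified X)
    {Y : ∀ α : Cotangent E Q m, TangentSpace (cotI E m) α} (hY : SolvesHamilton h Y) :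
    IsLegendrePushforward L (lagrangianField X) Y := by
  intro p
  refine symplecticForm_injective (legendre L p) fun v => ?_
  obtain ⟨u, rfl⟩ := exists_mfderiv_legendre hleg hG hGl hlG p v
  exact (hY _ _).trans (solvesHamilton_apply hL hleg hh hE hX hXs p u).symm

lemma solvesHamilton_of_solvesUnified (hL : ContMDiff (jetI E (m + 1)) 𝓘(ℝ, ℝ) ∞ L)
    (hleg : ContMDiff (jetI E (2 * m + 1)) (cotI E m) ∞ (legendre L))
    (hG : ContMDiff (cotI E m) (jetI E (2 * m + 1)) ∞ G)
    (hGl : ∀ p, G (legendre L p) = p) (hlG : ∀ α, legendre L (G α) = α)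
    {h : Cotangent E Q m → ℝ} (hh : ContMDiff (cotI E m) 𝓘(ℝ, ℝ) ∞ h)
    (hE : ∀ p : Jet E Q (2 * m + 1), h (legendre L p) = energy L p)
    {X : FieldOnWo L} (hX : TangentToWo X) (hXs : SolvesUnified X)
    {Y : ∀ α : Cotangent E Q m, TangentSpace (cotI E m) α}
    (hXY : IsLegendrePushforward L (lagrangianField X) Y) : SolvesHamilton h Y := by
  intro α
  obtain ⟨p, rfl⟩ : ∃ p, legendre L p = α := ⟨_, hlG α⟩
  intro v
  obtain ⟨u, rfl⟩ := exists_mfderiv_legendre hleg hG hGl hlG p v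
  rw [hXY p]
  exact solvesHamilton_apply hL hleg hh hE hX hXs p u

end Equivalence

end HigherOrder

end

/-! ### The equivalence theorem. -/

theorem mainTheorem2 {E : Type*} [NormedAddCommGroup E] [NormedSpace ℝ E] [FiniteDimensional ℝ E]
    {Q : Type*} [TopologicalSpace Q] [ChartedSpace E Q] [IsManifold 𝓘(ℝ, E) ∞ Q]
    {m : ℕ} (L : Jet E Q (m + 1) → ℝ) (hL : ContMDiff (jetI E (m + 1)) 𝓘(ℝ, ℝ) ∞ L)
    (hreg : Hyperregular L)
    (h : Cotangent E Q m → ℝ) (hh : ContMDiff (cotI E m) 𝓘(ℝ, ℝ) ∞ h)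
    (hE : ∀ p : Jet E Q (2 * m + 1), h (legendre L p) = energy L p) :
    (∀ X : FieldOnWo L, IsSmoothFieldOn (uniI E m) (Wo L) X → TangentToWo X → SolvesUnified X →
      IsSmoothField (jetI E (2 * m + 1)) (lagrangianField X) ∧
      ∃ Xh : ∀ α : Cotangent E Q m, TangentSpace (cotI E m) α,
        (IsSmoothField (cotI E m) Xh ∧ IsLegendrePushforward L (lagrangianField X) Xh ∧
          SolvesHamilton h Xh) ∧
        ∀ Y : ∀ α : Cotangent E Q m, TangentSpace (cotI E m) α,
          IsSmoothField (cotI E m) Y → SolvesHamilton h Y → Y = Xh) ∧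
    (∀ Xh : ∀ α : Cotangent E Q m, TangentSpace (cotI E m) α,
      IsSmoothField (cotI E m) Xh → SolvesHamilton h Xh →
      ∃ X : FieldOnWo L,
        (IsSmoothFieldOn (uniI E m) (Wo L) X ∧ TangentToWo X ∧ SolvesUnified X ∧
          IsLegendrePushforward L (lagrangianField X) Xh) ∧
        ∀ Y : FieldOnWo L, IsSmoothFieldOn (uniI E m) (Wo L) Y → TangentToWo Y →
          SolvesUnified Y → Y = X) := by
  obtain ⟨Φ, hΦ⟩ := hreg
  have hleg : ContMDiff (jetI E (2 * m + 1)) (cotI E m) ∞ (legendre L) := hΦ ▸ Φ.contMDiff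
  have hG : ContMDiff (cotI E m) (jetI E (2 * m + 1)) ∞ Φ.symm := Φ.symm.contMDiff
  have hGl : ∀ p, Φ.symm (legendre L p) = p := fun p => by rw [← hΦ]; exact Φ.symm_apply_apply p
  have hlG : ∀ α, legendre L (Φ.symm α) = α := fun α => by rw [← hΦ]; exact Φ.apply_symm_apply α
  refine ⟨fun X hX hXt hXs => ?_, fun Xh hXh hXhs => ?_⟩
  · have hXL := isSmoothField_lagrangianField hleg hX
    have hpush : IsLegendrePushforward L (lagrangianField X)
        (pushField (jetI E (2 * m + 1)) (cotI E m) (legendre L) Φ.symm (lagrangianField X)) :=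
      fun p => pushField_apply hGl (lagrangianField X) p
    have hsolve := solvesHamilton_of_solvesUnified hL hleg hG hGl hlG hh hE hXt hXs hpush
    refine ⟨hXL, _, ⟨isSmoothField_pushField hleg hG hlG hXL, hpush, hsolve⟩, fun Y _ hY => ?_⟩
    exact funext fun α => symplecticForm_injective α fun v => (hY α v).trans (hsolve α v).symm
  · have hpush := isLegendrePushforward_pullback hleg hG hGl hlG Xh
    have hsm := isSmoothField_pushField hG hleg hGl hXh
    refine ⟨graphField L (pushField (cotI E m) (jetI E (2 * m + 1)) Φ.symm (legendre L) Xh),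
      ⟨isSmoothFieldOn_graphField hleg hsm, tangentToWo_graphField _,
        solvesUnified_graphField hL hleg hG hGl hlG hh hE hpush hXhs, ?_⟩, fun Y _ hYt hYs => ?_⟩
    · rw [lagrangianField_graphField hleg]
      exact hpush
    -- Both fields project to fields that are `FL`-related to the same `Xh`. Injectivity of `TFL`
    -- equates the projections, and tangency recovers the fields from them.
    · funext ⟨w, hw⟩
      obtain ⟨p, rfl⟩ : ∃ p, graphMap L p = w := ⟨_, graphMap_pr1 hw⟩
      have h1 := isLegendrePushforward_of_solvesUnified hL hleg hG hGl hlG hh hE hYt hYs hXhs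
      have h2 := mfderiv_legendre_injective hleg hG hGl p ((h1 p).symm.trans (hpush p))
      rw [apply_graphMap_of_tangentToWo hleg hYt p, h2]
      rfl
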